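/- Let $p$ be a prime, $r\ge 1$, and let $k$ be an algebraically closed field of characteristic $p$. Let $X$ be a smooth $k$-curve (a separated $k$-scheme of finite type, smooth of relative dimension $1$). All sheaves are sheaves on the small étale site of $X$, and $\mathcal{O}_X$ is the étale structure sheaf. A left $\mathcal{O}_{F^r,X}$-module is a sheaf $\mathcal{M}$ of $\mathcal{O}_X$-modules with an additive endomorphism $F^r$ satisfying $F^r(am)=a^{p^r}F^r(m)$; it is *unit* if it is quasi-coherent over $\mathcal{O}_X$ and its structural morphism $F_X^{r*}\mathcal{M}\to\mathcal{M}$, $a\otimes m\mapsto aF^r(m)$, is an isomorphism, and it is *lfgu* if it is unit and its restriction to every affine open subscheme of $X$ is generated, as a left $\mathcal{O}_{F^r}$-module, by finitely many sections. A *root* of a unit module $\mathcal{M}$ is a coherent $\mathcal{O}_X$-submodule $\mathcal{M}_0\subseteq\mathcal{M}$ which is contained in the $\mathcal{O}_X$-submodule $\mathcal{M}_1$ of $\mathcal{M}$ generated by $F^r(\mathcal{M}_0)$ and which generates $\mathcal{M}$ as a left $\mathcal{O}_{F^r,X}$-module. **Theorem.** Let $\mathcal{M}$ be an lfgu $\mathcal{O}_{F^r,X}$-module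 which is torsion-free over $\mathcal{O}_X$, let $\mathcal{M}_0\subseteq\mathcal{M}$ be a root, and put $\mathcal{M}_0^\vee=\mathcal{H}om_{\mathcal{O}_X}(\mathcal{M}_0,\mathcal{O}_X)$ and $M=\mathcal{H}om_{\mathcal{O}_{F^r,X}}(\mathcal{M},\mathcal{O}_X)$, where $F^r$ acts on $\mathcal{O}_X$ by $a\mapsto a^{p^r}$. There is a unique endomorphism $F^r$ of the sheaf of abelian groups $\mathcal{M}_0^\vee$ which sends a local section $\varphi$ to the restriction to $\mathcal{M}_0$ of the $\mathcal{O}_X$-linear map $$\mathcal{M}_1\to\mathcal{O}_X,\qquad \sum_i a_iF^r(m_i)\mapsto\sum_i a_i\,\varphi(m_i)^{p^r}\qquad(m_i\in\mathcal{M}_0),$$ and, with the map $M\to\mathcal{M}_0^\vee$ given by restriction of homomorphisms to $\mathcal{M}_0$, the sequence of étale sheaves of abelian groups $$0\longrightarrow M\longrightarrow\mathcal{M}_0^\vee\xrightarrow{\;1-F^r\;}\mathcal{M}_0^\vee\longrightarrow 0$$ is exact. -/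

import Mathlib

universe u v w

open CategoryTheory Opposite AlgebraicGeometry

namespace FrobCurve

section StructureSheaf

variable (X : Scheme.{u})

/-- The structure presheaf `U ↦ Γ(U, O_U)` on the small étale site of `X`. -/
noncomputable def etaleO : X.Etaleᵒᵖ ⥤ CommRingCat.{u} :=
  (Scheme.Etale.forget X ⋙ Over.forget X).op ⋙ Scheme.Γ

lemma coverPreserving_small (P : MorphismProperty Scheme.{u}) [P.IsMultiplicative] [P.RespectsIso]
    [P.IsStableUnderBaseChange] :
    CoverPreserving (X.smallGrothendieckTopology (P := P) (Q := P))
      (X.overGrothendieckTopology P) (MorphismProperty.Over.forget P ⊤ X) :=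
  Functor.coverPreserving_restrictedTopology _ _

lemma isSheaf_yoneda_etale (Y : Scheme.{u}) :
    Presieve.IsSheaf X.smallEtaleTopology
      ((Scheme.Etale.forget X ⋙ Over.forget X).op ⋙ yoneda.obj Y) := by
  have h0 : Presheaf.IsSheaf Scheme.etaleTopology.{u} (yoneda.obj Y) :=
    Presheaf.IsSheaf.of_le (Scheme.etaleTopology_le_proetaleTopology.trans
      Scheme.proetaleTopology_le_fpqcTopology)
      ((isSheaf_iff_isSheaf_of_type _ _).2
        (GrothendieckTopology.Subcanonical.isSheaf_of_isRepresentable _))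
  have h1 : Presheaf.IsSheaf (Scheme.etaleTopology.{u}.over X) ((Over.forget X).op ⋙ yoneda.obj Y) :=
    (Over.forget X).op_comp_isSheaf_of_isSheaf _ Scheme.etaleTopology.{u} _ h0
  have : (Scheme.Etale.forget X).IsContinuous X.smallEtaleTopology (Scheme.etaleTopology.{u}.over X) := by
    have : RepresentablyFlat (Scheme.Etale.forget X) := flat_of_preservesFiniteLimits _
    have : MorphismProperty.RespectsIso (@Etale.{u}) :=
      MorphismProperty.IsStableUnderBaseChange.respectsIso
    exact Functor.isContinuous_of_coverPreserving (compatiblePreservingOfFlat _ _)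
      (coverPreserving_small (P := @Etale) X)
  exact (isSheaf_iff_isSheaf_of_type _ _).1
    ((Scheme.Etale.forget X).op_comp_isSheaf_of_isSheaf X.smallEtaleTopology
      (Scheme.etaleTopology.{u}.over X) _ h1)

lemma isSheaf_etaleO_forget :
    Presieve.IsSheaf X.smallEtaleTopology (etaleO X ⋙ forget CommRingCat) := by
  refine Presieve.isSheaf_iso _ ?_
    (isSheaf_yoneda_etale X (Spec (CommRingCat.of (MvPolynomial PUnit.{u+1} (ULift.{u} ℤ)))))
  refine NatIso.ofComponents (fun U => (Equiv.toIso
    ((AffineSpace.toSpecMvPolyIntEquiv PUnit.{u+1}).trans (Equiv.funUnique PUnit.{u+1} _)))) ?_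
  intro U V f
  refine ConcreteCategory.hom_ext _ _ fun g => ?_
  exact AffineSpace.toSpecMvPolyIntEquiv_comp _ ((Scheme.Etale.forget X ⋙ Over.forget X).map f.unop) g
    PUnit.unit

/-- A presheaf of rings whose underlying presheaf of sets is a sheaf is a sheaf. -/
lemma isSheaf_of_forget {C : Type v} [Category.{w} C] (J : GrothendieckTopology C)
    (P : Cᵒᵖ ⥤ RingCat.{u}) (h : Presieve.IsSheaf J (P ⋙ forget RingCat)) :
    Presheaf.IsSheaf J P := by
  intro E U S hS x hx
  have sep := (h.isSeparated S hS)
  have key : ∀ e : E, ∃! t : P.obj (op U), ∀ ⦃V⦄ (f : V ⟶ U) (hf : S f),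
      P.map f.op t = (x f hf).hom e := by
    intro e
    have := h S hS (fun V f hf => (x f hf).hom e) (by
      intro Y₁ Y₂ Z g₁ g₂ f₁ f₂ h₁ h₂ e'
      have := congr($(hx g₁ g₂ h₁ h₂ e').hom e)
      exact this)
    exact this
  choose t ht htu using key
  have ext : ∀ a b : P.obj (op U), (∀ ⦃V⦄ (f : V ⟶ U) (hf : S f), P.map f.op a = P.map f.op b) →
      a = b := by
    intro a b hab
    exact sep.ext fun V f hf => hab f hf
  refine ⟨RingCat.ofHom
    { toFun := t, map_one' := ?_, map_mul' := ?_, map_zero' := ?_, map_add' := ?_ }, ?_, ?_⟩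
  · exact ext _ _ fun V f hf => by rw [ht _ f hf]; simp
  · exact fun a b => ext _ _ fun V f hf => by rw [ht _ f hf, map_mul, map_mul, ht _ f hf, ht _ f hf]
  · exact ext _ _ fun V f hf => by rw [ht _ f hf]; simp
  · exact fun a b => ext _ _ fun V f hf => by rw [ht _ f hf, map_add, map_add, ht _ f hf, ht _ f hf]
  · intro V f hf
    refine RingCat.hom_ext (RingHom.ext fun e => ?_)
    exact ht e f hf
  · intro y hy
    refine RingCat.hom_ext (RingHom.ext fun e => ?_)
    refine htu e (y.hom e) fun V f hf => ?_
    have := congr($(hy f hf).hom e)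
    exact this

/-- The étale structure sheaf. -/
noncomputable abbrev etaleRing : Sheaf X.smallEtaleTopology RingCat.{u} :=
  ⟨etaleO X ⋙ forget₂ CommRingCat RingCat, isSheaf_of_forget _ _ (isSheaf_etaleO_forget X)⟩

end StructureSheaf

section QuasiCoherent

/-- Let `f : M → N` be semilinear along a ring homomorphism `φ : A → B`. This says that the induced
`B`-linear map `B ⊗_{A, φ} M → N`, `b ⊗ m ↦ b • f m`, is bijective. -/
def IsBaseChangeAlong {A B M N : Type*} [CommRing A] [CommRing B] [AddCommGroup M] [AddCommGroup N]
    [Module A M] [Module B N] {φ : A →+* B} (f : M →ₛₗ[φ] N) : Prop :=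
  letI : Algebra A B := φ.toAlgebra
  letI : Module A N := Module.compHom N φ
  haveI : IsScalarTower A B N := ⟨fun a b n => mul_smul (φ a) b n⟩
  IsBaseChange B
    ({ toFun := f, map_add' := f.map_add, map_smul' := fun a m => f.map_smulₛₗ a m } : M →ₗ[A] N)

variable {X : Scheme.{u}}

variable (X) in
/-- Presheaves of modules over the étale structure sheaf. -/
abbrev EtPMod := PresheafOfModules.{u} (etaleO X ⋙ forget₂ CommRingCat RingCat)

/-- The restriction map of a presheaf of modules along a morphism of étale `X`-schemes. -/
noncomputable def restr (P : EtPMod X) {U V : X.Etale} (f : V ⟶ U) :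
    P.obj (op U) →ₛₗ[((etaleO X).map f.op).hom] P.obj (op V) :=
  P.restrictₛₗ f.op

/-- A module `P` on the small étale site of `X` is quasi-coherent if for every morphism `V ⟶ U` of
affine schemes étale over `X` the canonical map `O(V) ⊗_{O(U)} P(U) → P(V)` is bijective. -/
def IsQuasicoherent (P : EtPMod X) : Prop :=
  ∀ ⦃U V : X.Etale⦄ (f : V ⟶ U), IsAffine U.left → IsAffine V.left → IsBaseChangeAlong (restr P f)

/-- Coherent modules on a (locally noetherian) scheme: quasi-coherent, with finitely generated
sections over affines. -/
def IsCoherent (P : EtPMod X) : Prop :=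
  IsQuasicoherent P ∧
    ∀ U : X.Etale, IsAffine U.left → Module.Finite ((etaleO X).obj (op U)) (P.obj (op U))

/-- `P` is a torsion-free `O_X`-module: nonzerodivisors on affines act injectively on sections. -/
def IsTorsionFree (P : EtPMod X) : Prop :=
  ∀ U : X.Etale, IsAffine U.left →
    ∀ a ∈ nonZeroDivisors ((etaleO X).obj (op U)), ∀ m : P.obj (op U), a • m = 0 → m = 0

/-- Let `T` be a collection of sections of `P`. The section `m` of `P` lies, étale locally, in the
`O_X`-span of `T`; if `T` is stable under restriction, this says that `m` is a section of the
`O_X`-submodule of `P` generated by `T`. -/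
def LocallyInSpan (P : EtPMod X) (T : ∀ U : X.Etale, Set (P.obj (op U))) {U : X.Etale}
    (m : P.obj (op U)) : Prop :=
  ∃ S ∈ X.smallEtaleTopology U, ∀ ⦃V : X.Etale⦄ (f : V ⟶ U), S f →
    restr P f m ∈ Submodule.span ((etaleO X).obj (op V)) (T V)

end QuasiCoherent

section FrobeniusModules

variable {k : Type u} [Field k] {X : Scheme.{u}} (π : X ⟶ Spec (.of k)) (p r : ℕ)

lemma natCast_eq_zero {k : Type u} [Field k] {X : Scheme.{u}} (π : X ⟶ Spec (.of k)) (p : ℕ)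
    [CharP k p] (U : X.Etale) : (p : (etaleO X).obj (op U)) = 0 := by
  let φ : k →+* (etaleO X).obj (op U) :=
    ((Scheme.ΓSpecIso (.of k)).inv ≫ (U.hom ≫ π).appTop).hom
  rw [← map_natCast φ p, CharP.cast_eq_zero, map_zero]

/-- The `r`-th power `a ↦ a ^ (p ^ r)` of the Frobenius endomorphism of `O(U)`, for `U` étale over
a scheme `X` over a field of characteristic `p`. -/
noncomputable def frobPow [Fact p.Prime] [CharP k p] (U : X.Etale) :
    (etaleO X).obj (op U) →+* (etaleO X).obj (op U) where
  toFun a := a ^ (p ^ r)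
  map_one' := one_pow _
  map_mul' a b := mul_pow a b _
  map_zero' := zero_pow (pow_ne_zero _ (Fact.out : p.Prime).ne_zero)
  map_add' a b := by
    obtain ⟨c, hc⟩ := exists_add_pow_prime_pow_eq (Fact.out : p.Prime) a b r
    have hp := natCast_eq_zero π p U
    rw [hc, hp]
    simp

variable (X) in
/-- A sheaf of left modules over the sheaf of twisted polynomial rings `O_{F^r, X}`, with
`q = p ^ r`: a sheaf of `O_X`-modules on the small étale site with an additive endomorphism `F`
(the action of `F^r`) such that `F (a m) = a ^ q F (m)`. -/
structure FrobeniusModule (q : ℕ) where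
  /-- the underlying sheaf of `O_X`-modules -/
  toSheaf : SheafOfModules.{u} (etaleRing X)
  /-- the action of `F^r` -/
  F (U : X.Etale) : toSheaf.val.obj (op U) →+ toSheaf.val.obj (op U)
  F_smul (U : X.Etale) (a : (etaleO X).obj (op U)) (m : toSheaf.val.obj (op U)) :
    F U (a • m) = a ^ q • F U m
  F_restr {U V : X.Etale} (f : V ⟶ U) (m : toSheaf.val.obj (op U)) :
    F V (toSheaf.val.map f.op m) = toSheaf.val.map f.op (F U m)

namespace FrobeniusModule

/-- The underlying presheaf of modules. -/
abbrev val {q : ℕ} (M : FrobeniusModule X q) : EtPMod X := M.toSheaf.val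

variable {p r}

/-- The action of `F^r`, as a semilinear map. -/
noncomputable def Fₛₗ [Fact p.Prime] [CharP k p] (M : FrobeniusModule X (p ^ r)) (U : X.Etale) :
    M.val.obj (op U) →ₛₗ[frobPow π p r U] M.val.obj (op U) where
  toFun := M.F U
  map_add' := map_add (M.F U)
  map_smul' := M.F_smul U

/-- A unit `O_{F^r, X}`-module: quasi-coherent over `O_X`, and the structural morphism
`F_X^{r*} M → M`, `a ⊗ m ↦ a F^r(m)`, is an isomorphism. -/
def IsUnit [Fact p.Prime] [CharP k p] (M : FrobeniusModule X (p ^ r)) : Prop :=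
  IsQuasicoherent M.val ∧
    ∀ U : X.Etale, IsAffine U.left → IsBaseChangeAlong (M.Fₛₗ π U)

/-- `M` is locally finitely generated: its restriction to any affine open subscheme `U` of `X` is
generated as a left `O_{F^r, U}`-module by finitely many sections. -/
def IsLocallyFG {q : ℕ} (M : FrobeniusModule X q) : Prop :=
  ∀ U : X.Etale, IsOpenImmersion U.hom → IsAffine U.left →
    ∃ s : Finset (M.val.obj (op U)), ∀ ⦃V : X.Etale⦄ (f : V ⟶ U) (m : M.val.obj (op V)),
      ∃ S ∈ X.smallEtaleTopology V, ∀ ⦃W : X.Etale⦄ (g : W ⟶ V), S g →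
        restr M.val g m ∈ Submodule.span ((etaleO X).obj (op W))
          {x | ∃ (i : ℕ) (y : M.val.obj (op U)), y ∈ s ∧
            x = (M.F W)^[i] (restr M.val (g ≫ f) y)}

/-- Locally finitely generated unit `O_{F^r, X}`-modules. -/
def IsLFGU [Fact p.Prime] [CharP k p] (M : FrobeniusModule X (p ^ r)) : Prop :=
  M.IsUnit π ∧ M.IsLocallyFG

/-- An `O_X`-submodule `N` of `M` is a root if it is coherent, it is contained in the
`O_X`-submodule generated by `F^r(N)`, and it generates `M` as a left `O_{F^r, X}`-module. -/
structure IsRoot {q : ℕ} (M : FrobeniusModule X q) (N : M.val.Submodule) : Prop where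
  isSheaf : Presheaf.IsSheaf X.smallEtaleTopology N.toPresheafOfModules.presheaf
  isCoherent : IsCoherent N.toPresheafOfModules
  le_span : ∀ (U : X.Etale) (m : M.val.obj (op U)), m ∈ N.obj (op U) →
    LocallyInSpan M.val (fun V => M.F V '' {n | n ∈ N.obj (op V)}) m
  generates : ∀ (U : X.Etale) (m : M.val.obj (op U)),
    LocallyInSpan M.val (fun V => ⋃ i : ℕ, (M.F V)^[i] '' {n | n ∈ N.obj (op V)}) m

end FrobeniusModule

end FrobeniusModules

section InternalHom

variable {X : Scheme.{u}}

/-- For each `V` let `C V` be a group of additive maps `P(V) → O(V)`. This is the group of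
morphisms `P|_U → O_U` of presheaves on the étale site of `U` whose components lie in `C`. -/
noncomputable def homFamilies (P : EtPMod X)
    (C : ∀ V : X.Etale, AddSubgroup (P.obj (op V) →+ (etaleO X).obj (op V))) (U : X.Etale) :
    AddSubgroup (∀ ⦃V : X.Etale⦄ (_ : V ⟶ U), P.obj (op V) →+ (etaleO X).obj (op V)) where
  carrier := {φ | (∀ ⦃V : X.Etale⦄ (f : V ⟶ U), φ f ∈ C V) ∧
    ∀ ⦃V W : X.Etale⦄ (f : V ⟶ U) (g : W ⟶ V) (m : P.obj (op V)),
      φ (g ≫ f) (restr P g m) = (etaleO X).map g.op (φ f m)}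
  zero_mem' := ⟨fun V _ => (C V).zero_mem, fun _ _ _ _ _ => (map_zero _).symm⟩
  add_mem' {φ ψ} hφ hψ := ⟨fun V f => (C V).add_mem (hφ.1 f) (hψ.1 f), fun V W f g m => by
    have h1 := hφ.2 f g m
    have h2 := hψ.2 f g m
    simp only [Pi.add_apply, AddMonoidHom.add_apply, map_add, h1, h2]⟩
  neg_mem' {φ} hφ := ⟨fun V f => (C V).neg_mem (hφ.1 f), fun V W f g m => by
    have h1 := hφ.2 f g m
    simp only [Pi.neg_apply, AddMonoidHom.neg_apply, map_neg, h1]⟩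

/-- The presheaf `U ↦ homFamilies P C U` of abelian groups. -/
noncomputable def homPresheaf (P : EtPMod X)
    (C : ∀ V : X.Etale, AddSubgroup (P.obj (op V) →+ (etaleO X).obj (op V))) :
    X.Etaleᵒᵖ ⥤ AddCommGrpCat.{u + 1} where
  obj U := AddCommGrpCat.of (homFamilies P C U.unop)
  map h := AddCommGrpCat.ofHom
    { toFun φ := ⟨fun _ f => φ.1 (f ≫ h.unop), fun _ f => φ.2.1 (f ≫ h.unop), fun V W f g m => by
        have := φ.2.2 (f ≫ h.unop) g m
        rwa [← Category.assoc] at this⟩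
      map_zero' := rfl
      map_add' _ _ := rfl }
  map_id U := by
    refine AddCommGrpCat.hom_ext (AddMonoidHom.ext fun φ => Subtype.ext ?_)
    funext V f
    exact congrArg (fun g => φ.1 g) (Category.comp_id f)
  map_comp h h' := by
    refine AddCommGrpCat.hom_ext (AddMonoidHom.ext fun φ => Subtype.ext ?_)
    funext V f
    exact congrArg (fun g => φ.1 g) (Category.assoc f h'.unop h.unop).symm

lemma isSheaf_homPresheaf (P : EtPMod X)
    (C : ∀ V : X.Etale, AddSubgroup (P.obj (op V) →+ (etaleO X).obj (op V)))
    (hC : ∀ (V : X.Etale) (t : P.obj (op V) →+ (etaleO X).obj (op V)),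
      ∀ S ∈ X.smallEtaleTopology V,
      (∀ ⦃W : X.Etale⦄ (g : W ⟶ V), S g → ∃ t' ∈ C W, ∀ m,
        (etaleO X).map g.op (t m) = t' (restr P g m)) → t ∈ C V) :
    Presheaf.IsSheaf X.smallEtaleTopology (homPresheaf P C) := by
  rw [Presheaf.isSheaf_iff_isSheaf_forget _ _ (forget AddCommGrpCat.{u + 1}),
    isSheaf_iff_isSheaf_of_type]
  intro U S hS x hx
  -- transitivity of the family `x`
  have hcomp : ∀ ⦃V W W' : X.Etale⦄ (f : V ⟶ U) (hf : S f) (h : W ⟶ V) (h' : W' ⟶ W)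
      (hh : S (h ≫ f)) (m : P.obj (op W')),
      (x (h ≫ f) hh).1 h' m = (x f hf).1 (h' ≫ h) m := by
    intro V W W' f hf h h' hh m
    have e := hx (𝟙 W) h hh hf (Category.id_comp _)
    have e' := congrFun (congrArg (fun g => g.1) e) W'
    have e1 : (x (h ≫ f) hh).1 (h' ≫ 𝟙 W) m = (x f hf).1 (h' ≫ h) m :=
      congrArg (fun g => (g h') m) e'
    rwa [Category.comp_id] at e1
  have hO := isSheaf_etaleO_forget X
  -- pointwise glueing
  have key : ∀ ⦃V : X.Etale⦄ (g : V ⟶ U) (m : P.obj (op V)), ∃ s : (etaleO X).obj (op V),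
      ∀ ⦃W : X.Etale⦄ (h : W ⟶ V) (hh : S (h ≫ g)),
        (etaleO X).map h.op s = (x (h ≫ g) hh).1 (𝟙 W) (restr P h m) := by
    intro V g m
    obtain ⟨s, hs, -⟩ := hO (S.pullback g) (X.smallEtaleTopology.pullback_stable g hS)
      (fun W h hh => (x (h ≫ g) hh).1 (𝟙 W) (restr P h m)) (by
        intro W₁ W₂ Z g₁ g₂ f₁ f₂ h₁ h₂ e
        have aux : ∀ ⦃W : X.Etale⦄ (f : W ⟶ V) (hf : S (f ≫ g)) (g' : Z ⟶ W)
            (hh : S ((g' ≫ f) ≫ g)),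
            (etaleO X).map g'.op ((x (f ≫ g) hf).1 (𝟙 W) (restr P f m)) =
              (x ((g' ≫ f) ≫ g) hh).1 (𝟙 Z) (restr P (g' ≫ f) m) := by
          intro W f hf g' hh
          have e1 := (x (f ≫ g) hf).2.2 (𝟙 W) g' (restr P f m)
          rw [← e1]
          have e2 : restr P g' (restr P f m) = restr P (g' ≫ f) m :=
            (P.map_comp_apply f.op g'.op m).symm
          rw [e2]
          have hh' : S (g' ≫ f ≫ g) := by rwa [← Category.assoc]
          have e3 := hcomp (f ≫ g) hf g' (𝟙 Z) hh' (restr P (g' ≫ f) m)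
          have e4 : (x ((g' ≫ f) ≫ g) hh).1 (𝟙 Z) (restr P (g' ≫ f) m) =
              (x (g' ≫ f ≫ g) hh').1 (𝟙 Z) (restr P (g' ≫ f) m) := by
            congr! 3
          rw [e4, e3, Category.comp_id, Category.id_comp]
        have hh₁ : S ((g₁ ≫ f₁) ≫ g) := by
          rw [Category.assoc]; exact S.downward_closed h₁ g₁
        have hh₂ : S ((g₂ ≫ f₂) ≫ g) := e ▸ hh₁
        refine (aux f₁ h₁ g₁ hh₁).trans (Eq.trans ?_ (aux f₂ h₂ g₂ hh₂).symm)
        revert hh₁ hh₂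
        rw [e]
        exact fun _ _ => rfl)
    exact ⟨s, fun W h hh => hs h hh⟩
  have ext : ∀ ⦃V : X.Etale⦄ (g : V ⟶ U) (a b : (etaleO X).obj (op V)),
      (∀ ⦃W : X.Etale⦄ (h : W ⟶ V), S (h ≫ g) →
        (etaleO X).map h.op a = (etaleO X).map h.op b) → a = b := fun V g a b hab =>
    (hO.isSeparated (S.pullback g) (X.smallEtaleTopology.pullback_stable g hS)).ext
      fun W h hh => hab h hh
  choose t ht using key
  let φ : ∀ ⦃V : X.Etale⦄ (_ : V ⟶ U), P.obj (op V) →+ (etaleO X).obj (op V) := fun V g =>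
    AddMonoidHom.mk' (t g) fun a b => ext g _ _ fun W h hh => by
      rw [ht g _ h hh, map_add, map_add, map_add, ht g _ h hh, ht g _ h hh]
  have hφ : φ ∈ homFamilies P C U := by
    refine ⟨fun V g => hC V _ _ (X.smallEtaleTopology.pullback_stable g hS) fun W h hh =>
      ⟨_, (x (h ≫ g) hh).2.1 (𝟙 W), fun m => ht g m h hh⟩, fun V W g h m => ?_⟩
    refine ext (h ≫ g) _ _ fun W' h' hh => ?_
    have hh' : S ((h' ≫ h) ≫ g) := by rwa [Category.assoc]
    have e1 := ht (h ≫ g) (restr P h m) h' hh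
    have e2 := ht g m (h' ≫ h) hh'
    have e3 : restr P h' (restr P h m) = restr P (h' ≫ h) m :=
      (P.map_comp_apply h.op h'.op m).symm
    have e4 : (etaleO X).map h'.op ((etaleO X).map h.op (t g m)) =
        (etaleO X).map (h' ≫ h).op (t g m) := by
      rw [op_comp, Functor.map_comp]; rfl
    refine e1.trans (Eq.trans ?_ (e2.symm.trans e4.symm))
    rw [e3]
    congr! 3
  refine ⟨⟨φ, hφ⟩, fun V f hf => Subtype.ext ?_, fun ψ hψ => Subtype.ext ?_⟩
  · funext W g
    refine AddMonoidHom.ext fun m => ?_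
    have hh : S (g ≫ f) := S.downward_closed hf g
    have hh' : S (𝟙 W ≫ g ≫ f) := by rwa [Category.id_comp]
    have e1 := ht (g ≫ f) m (𝟙 W) hh'
    have e2 : (etaleO X).map (𝟙 W).op (t (g ≫ f) m) = t (g ≫ f) m := by
      rw [op_id, CategoryTheory.Functor.map_id]; rfl
    have e3 : restr P (𝟙 W) m = m := by
      have := P.congr_map_apply (op_id (X := W)) m
      refine this.trans ?_
      rw [P.map_id]
      rfl
    have e4 := hcomp f hf g (𝟙 W) hh m
    have e5 : (x (𝟙 W ≫ g ≫ f) hh').1 (𝟙 W) m = (x (g ≫ f) hh).1 (𝟙 W) m := by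
      congr! 3
    rw [Category.id_comp] at e4
    rw [e3, e5, e4] at e1
    exact e2.symm.trans e1
  · funext V g
    refine AddMonoidHom.ext fun m => ext g _ _ fun W h hh => ?_
    have e1 := ψ.2.2 g h m
    have e2 := ht g m h hh
    have e3 := congrFun (congrArg (fun g => g.1) (hψ (h ≫ g) hh)) W
    have e4 : ψ.1 (𝟙 W ≫ h ≫ g) (restr P h m) = (x (h ≫ g) hh).1 (𝟙 W) (restr P h m) :=
      congrArg (fun y => (y (𝟙 W)) (restr P h m)) e3
    rw [Category.id_comp] at e4
    exact e1.symm.trans (e4.trans e2.symm)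

/-- The `O(V)`-linear maps `P(V) → O(V)`. -/
def linearMaps (P : EtPMod X) (V : X.Etale) :
    AddSubgroup (P.obj (op V) →+ (etaleO X).obj (op V)) where
  carrier := {t | ∀ (a : (etaleO X).obj (op V)) (m : P.obj (op V)), t (a • m) = a * t m}
  zero_mem' _ _ := (mul_zero _).symm
  add_mem' {s t} hs ht a m := by
    simp only [AddMonoidHom.add_apply, hs a m, ht a m, mul_add]
  neg_mem' {t} ht a m := by
    simp only [AddMonoidHom.neg_apply, ht a m, mul_neg]

lemma etaleO_ext {V : X.Etale} {S : Sieve V} (hS : S ∈ X.smallEtaleTopology V)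
    {a b : (etaleO X).obj (op V)}
    (h : ∀ ⦃W : X.Etale⦄ (g : W ⟶ V), S g → (etaleO X).map g.op a = (etaleO X).map g.op b) :
    a = b :=
  ((isSheaf_etaleO_forget X).isSeparated S hS).ext h

lemma linearMaps_local (P : EtPMod X) (V : X.Etale)
    (t : P.obj (op V) →+ (etaleO X).obj (op V)) (S : Sieve V) (hS : S ∈ X.smallEtaleTopology V)
    (h : ∀ ⦃W : X.Etale⦄ (g : W ⟶ V), S g → ∃ t' ∈ linearMaps P W, ∀ m,
      (etaleO X).map g.op (t m) = t' (restr P g m)) : t ∈ linearMaps P V := by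
  intro a m
  refine etaleO_ext hS fun W g hg => ?_
  obtain ⟨t', ht', e⟩ := h g hg
  rw [e, map_mul, e, (restr P g).map_smulₛₗ]
  exact ht' _ _

/-- The sheaf `Hom_{O_X}(P, O_X)` on the small étale site of `X`. -/
noncomputable def dual (P : EtPMod X) : Sheaf X.smallEtaleTopology AddCommGrpCat.{u + 1} :=
  ⟨homPresheaf P (linearMaps P), isSheaf_homPresheaf P _ (linearMaps_local P)⟩

namespace FrobeniusModule

variable {k : Type u} [Field k] (π : X ⟶ Spec (.of k)) {p r : ℕ} [Fact p.Prime] [CharP k p]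
  (M : FrobeniusModule X (p ^ r))

/-- The left `O(V)[F^r]`-linear maps `M(V) → O(V)`, where `F^r` acts on `O(V)` as
`a ↦ a ^ (p ^ r)`. -/
noncomputable def frobLinearMaps (V : X.Etale) :
    AddSubgroup (M.val.obj (op V) →+ (etaleO X).obj (op V)) where
  carrier := {t | t ∈ linearMaps M.val V ∧ ∀ m : M.val.obj (op V), t (M.F V m) = t m ^ (p ^ r)}
  zero_mem' := ⟨zero_mem _, fun _ => (map_zero (frobPow π p r V)).symm⟩
  add_mem' {s t} hs ht := ⟨add_mem hs.1 ht.1, fun m => by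
    simp only [AddMonoidHom.add_apply, hs.2 m, ht.2 m]
    exact (map_add (frobPow π p r V) _ _).symm⟩
  neg_mem' {t} ht := ⟨neg_mem ht.1, fun m => by
    simp only [AddMonoidHom.neg_apply, ht.2 m]
    exact (map_neg (frobPow π p r V) _).symm⟩

lemma frobLinearMaps_local (V : X.Etale)
    (t : M.val.obj (op V) →+ (etaleO X).obj (op V)) (S : Sieve V)
    (hS : S ∈ X.smallEtaleTopology V)
    (h : ∀ ⦃W : X.Etale⦄ (g : W ⟶ V), S g → ∃ t' ∈ frobLinearMaps π M W, ∀ m,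
      (etaleO X).map g.op (t m) = t' (restr M.val g m)) : t ∈ frobLinearMaps π M V := by
  refine ⟨linearMaps_local M.val V t S hS fun W g hg => ?_, fun m => etaleO_ext hS fun W g hg => ?_⟩
  · obtain ⟨t', ht', e⟩ := h g hg
    exact ⟨t', ht'.1, e⟩
  · obtain ⟨t', ht', e⟩ := h g hg
    rw [e, map_pow, e, ← ht'.2]
    exact congrArg t' (M.F_restr g m).symm

/-- The sheaf `Hom_{O_{F^r, X}}(M, O_X)` on the small étale site of `X`. -/
noncomputable def solutions : Sheaf X.smallEtaleTopology AddCommGrpCat.{u + 1} :=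
  ⟨homPresheaf M.val (frobLinearMaps π M), isSheaf_homPresheaf M.val _ (frobLinearMaps_local π M)⟩

/-- Restriction of homomorphisms to an `O_X`-submodule `N` of `M`:
`Hom_{O_{F^r, X}}(M, O_X) → Hom_{O_X}(N, O_X)`. -/
noncomputable def restrict (N : M.val.Submodule) :
    M.solutions π ⟶ dual N.toPresheafOfModules where
  hom :=
    { app _ := AddCommGrpCat.ofHom
        { toFun φ := ⟨fun V f => (φ.1 f).comp (N.obj (op V)).subtype.toAddMonoidHom,
            fun _ f a m => (φ.2.1 f).1 a m.1, fun _ _ f g m => φ.2.2 f g m.1⟩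
          map_zero' := rfl
          map_add' _ _ := rfl }
      naturality _ _ _ := rfl }

/-- Let `N` be an `O_X`-submodule of `M`. The endomorphism `Φ` of `N^∨ = Hom_{O_X}(N, O_X)` is the
action of `F^r`: it sends `φ` to the restriction to `N` of the map `∑ aᵢ F^r(xᵢ) ↦ ∑ aᵢ φ(xᵢ)^q` on
the `O_X`-submodule of `M` generated by `F^r(N)`, where `q = p ^ r`. -/
def IsDualFrobenius {q : ℕ} (M : FrobeniusModule X q) (N : M.val.Submodule)
    (Φ : dual N.toPresheafOfModules ⟶ dual N.toPresheafOfModules) : Prop :=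
  ∀ (U : X.Etale) (φ : homFamilies N.toPresheafOfModules (linearMaps N.toPresheafOfModules) U)
    ⦃V : X.Etale⦄ (f : V ⟶ U) (n : ℕ) (a : Fin n → (etaleO X).obj (op V))
    (x : Fin n → N.obj (op V)) (m : N.obj (op V)),
    m.1 = ∑ i, a i • M.F V (x i).1 →
      (show homFamilies N.toPresheafOfModules (linearMaps N.toPresheafOfModules) U from
        Φ.hom.app (op U) φ).1 f m = ∑ i, a i * φ.1 f (x i) ^ q

end FrobeniusModule

end InternalHom

end FrobCurve

/-! Write q for p^r. Étale locally X is étale over the affine line, so the sections over small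
affines form a ring étale over a principal ideal domain. On such a ring the q-power map is flat
(`flat_of_etale_of_pow`).

Frobenius on the dual. Let φ be linear on M₀. Since M is unit, M is the base change of itself along
the q-power map, with F as the structural map. Flat base change of the graph of φ therefore still
projects injectively to M (`SingleValued.span_image`), so ∑ aᵢF(mᵢ) = 0 forces ∑ aᵢφ(mᵢ)^q = 0. The
same argument iterates: for each i the span `frobRel φ i` of the pairs (F^i m, φ(m)^(q^i)) is
single-valued. Working with such submodules of M × O replaces the construction of the sheaves M₁,
M₂, … and of maps on them; `RelationFamily.exists_homFamily` turns a stable, locally total,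
single-valued family of relations into a homomorphism.

Left exactness. An F-linear map is determined on M₀ because M₀ generates M under F and O. If φ = Fφ,
the relations `frobRel φ i` locally increase with i, and their union is the graph of an F-linear
extension of φ to M (`exists_restrict_eq`).

Surjectivity. Torsion-freeness makes M₀ locally free. With a basis satisfying eᵢ = ∑ bᵢⱼF(eⱼ),
solving ψ - Fψ = φ means solving yᵢ - ∑ bᵢⱼyⱼ^q = cᵢ with cᵢ = φ(eᵢ). In characteristic p the
Jacobian of this system is the identity, so its solution scheme is étale. It meets every geometric
fibre because 1 - T is surjective for a q-linear T over an algebraically closed field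
(`exists_sub_semilinear_eq`). Hence solutions exist étale locally (`exists_sub_eq`). -/

namespace FrobCurve

/-! ### Flatness over étale algebras of dimension one, and single-valued relations. -/

section Algebra

/-- Étale coordinates on a smooth curve take values in this polynomial ring; being a principal ideal
domain, it is Dedekind, as the flatness lemmas require. -/
instance isPrincipalIdealRing_mvPolynomial_fin_one (k : Type*) [Field k] :
    IsPrincipalIdealRing (MvPolynomial (Fin 1) k) :=
  IsPrincipalIdealRing.of_surjective
    (MvPolynomial.uniqueAlgEquiv k (Fin 1)).symm.toRingEquiv.toRingHom
    (MvPolynomial.uniqueAlgEquiv k (Fin 1)).symm.surjective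

/-- A module over an étale algebra `A` over a Dedekind domain `B` is flat over `A` as soon as it is
torsion-free over `B`. -/
lemma flat_of_etale_of_torsionFree {B A N : Type*} [CommRing B] [IsDedekindDomain B] [CommRing A]
    [AddCommGroup N] [Module A N] {g : B →+* A} (hg : g.Etale)
    (h : ∀ b : B, b ≠ 0 → ∀ n : N, g b • n = 0 → n = 0) : Module.Flat A N := by
  algebraize [g]
  let : Module B N := Module.compHom N g
  have : IsScalarTower B A N := ⟨fun b a n => by
    rw [Algebra.smul_def, mul_smul]; rfl⟩
  have : Module.IsTorsionFree B N := by
    refine ⟨fun b hb x y hxy => ?_⟩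
    have hb0 : b ≠ 0 := hb.ne_zero
    refine sub_eq_zero.1 (h b hb0 _ ?_)
    rw [smul_sub, sub_eq_zero]
    exact hxy
  -- Torsion-free over a Dedekind domain is flat, and flatness over `B` implies flatness over `A`
  -- because `A` is unramified over `B`.
  exact Algebra.FormallyUnramified.flat_of_restrictScalars B A N

lemma mem_nonZeroDivisors_of_etale {B A : Type*} [CommRing B] [IsDomain B] [CommRing A]
    {g : B →+* A} (hg : g.Etale) {b : B} (hb : b ≠ 0) : g b ∈ nonZeroDivisors A := by
  algebraize [g]
  have h : IsSMulRegular A b :=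
    Module.Flat.isSMulRegular_of_nonZeroDivisors (mem_nonZeroDivisors_of_ne_zero hb)
  rw [mem_nonZeroDivisors_iff_right]
  intro x hx
  refine h ?_
  simp only [Algebra.smul_def, mul_zero]
  rw [mul_comm]; exact hx

/-- An endomorphism of an étale algebra over a Dedekind domain which is a power map is flat. -/
lemma flat_of_etale_of_pow {B A : Type*} [CommRing B] [IsDedekindDomain B] [CommRing A]
    {g : B →+* A} (hg : g.Etale) {σ : A →+* A} {q : ℕ} (hσ : ∀ a, σ a = a ^ q) : σ.Flat := by
  let := Module.compHom A σ
  refine flat_of_etale_of_torsionFree hg fun b hb n hn => ?_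
  -- In the module twisted by `σ`, the element `b` acts as multiplication by `g b ^ q`.
  have h1 : g b ^ q ∈ nonZeroDivisors A := pow_mem (mem_nonZeroDivisors_of_etale hg hb) q
  have h2 : g b ^ q * n = 0 := by rw [← hσ]; exact hn
  rw [mem_nonZeroDivisors_iff_right] at h1
  exact h1 n (by rw [mul_comm]; exact h2)

/-- An additive relation between modules is single-valued if it relates `0` only to `0`. -/
def SingleValued {A M L : Type*} [CommRing A] [AddCommGroup M] [AddCommGroup L] [Module A M]
    [Module A L] (R : Submodule A (M × L)) : Prop :=
  ∀ s : L, ((0 : M), s) ∈ R → s = 0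

/-- Base change of single-valued relations along a flat ring homomorphism. -/
lemma SingleValued.span_image {A B M M' L L' : Type*} [CommRing A] [CommRing B] [AddCommGroup M]
    [AddCommGroup M'] [AddCommGroup L] [AddCommGroup L'] [Module A M] [Module B M'] [Module A L]
    [Module B L'] {φ : A →+* B} (hφ : φ.Flat) {f : M →ₛₗ[φ] M'} (hf : IsBaseChangeAlong f)
    (g : L →ₛₗ[φ] L') {R : Submodule A (M × L)} (hR : SingleValued R) :
    SingleValued (Submodule.span B ((fun x : M × L => (f x.1, g x.2)) '' R)) := by
  let : Algebra A B := φ.toAlgebra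
  let : Module A M' := Module.compHom M' φ
  let : Module A L' := Module.compHom L' φ
  have : IsScalarTower A B M' := ⟨fun a b n => mul_smul (φ a) b n⟩
  have : IsScalarTower A B L' := ⟨fun a b n => mul_smul (φ a) b n⟩
  have : Module.Flat A B := hφ
  let f' : M →ₗ[A] M' :=
    { toFun := f, map_add' := f.map_add, map_smul' := fun a m => f.map_smulₛₗ a m }
  let g' : L →ₗ[A] L' :=
    { toFun := g, map_add' := g.map_add, map_smul' := fun a m => g.map_smulₛₗ a m }
  have hf' : IsBaseChange B f' := hf
  let T : TensorProduct A B R →ₗ[B] M' × L' :=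
    TensorProduct.AlgebraTensorModule.lift
      ((LinearMap.toSpanSingleton B (R →ₗ[A] M' × L')
        ((f'.prodMap g').comp R.subtype)).restrictScalars B)
  have hT : ∀ (b : B) (x : R), T (b ⊗ₜ x) = b • (f x.1.1, g x.1.2) := fun b x => rfl
  let P1 : R →ₗ[A] M := (LinearMap.fst A M L).comp R.subtype
  have hP1 : Function.Injective P1 := by
    rw [injective_iff_map_eq_zero]
    rintro ⟨⟨m, s⟩, hx⟩ h
    obtain rfl : m = 0 := h
    obtain rfl := hR s hx
    rfl
  -- Up to the identification of `B ⊗ M` with `M'`, the first coordinate of `T` is the base change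
  -- of the projection `R → M`. That projection is injective by single-valuedness, and flatness
  -- preserves this.
  have key : ∀ z, (T z).1 = hf'.equiv (P1.baseChange B z) := by
    intro z
    induction z using TensorProduct.induction_on with
    | zero => simp
    | add x y hx hy => rw [map_add, Prod.fst_add, hx, hy, map_add, map_add]
    | tmul b x => rw [hT]; simp [P1, f', IsBaseChange.equiv_tmul]
  intro s hs
  have hr : Submodule.span B ((fun x : M × L => (f x.1, g x.2)) '' R) ≤ LinearMap.range T := by
    rw [Submodule.span_le]
    rintro _ ⟨x, hx, rfl⟩
    exact ⟨1 ⊗ₜ ⟨x, hx⟩, by rw [hT, one_smul]⟩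
  obtain ⟨z, hz⟩ := hr hs
  have h1 := key z
  rw [hz] at h1
  have h2 : P1.baseChange B z = 0 := by
    rw [← hf'.equiv.map_eq_zero_iff]; exact h1.symm
  have h3 : z = 0 :=
    (injective_iff_map_eq_zero _).1 (Module.Flat.lTensor_preserves_injective_linearMap P1 hP1) z h2
  rw [h3, map_zero] at hz
  exact (congrArg Prod.snd hz).symm

/-- Since `q` does not divide 1, the linear coefficient of Q(X^q) - X is -1; the polynomial is not
constant and so has a root. -/
lemma exists_eq_eval_expand {K : Type*} [Field K] [IsAlgClosed K] {q : ℕ} (hq : 1 < q)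
    (Q : Polynomial K) : ∃ z : K, Q.eval (z ^ q) = z := by
  have h : (Polynomial.expand K q Q - Polynomial.X).degree ≠ 0 := by
    intro h
    have h1 := Polynomial.eq_C_of_degree_eq_zero h
    have h2 := congrArg (fun P => Polynomial.coeff P 1) h1
    have h3 : ¬ q ∣ 1 := fun h => by have := Nat.le_of_dvd one_pos h; omega
    simp [Polynomial.coeff_expand (by omega : 0 < q), h3] at h2
  obtain ⟨z, hz⟩ := IsAlgClosed.exists_root _ h
  refine ⟨z, ?_⟩
  simpa [Polynomial.IsRoot, Polynomial.expand_eval, sub_eq_zero] using hz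

/-- Let `T` be a `q`-linear endomorphism of a finite-dimensional vector space over an algebraically
closed field, where `q > 1`. Then `1 - T` is surjective. -/
lemma exists_sub_semilinear_eq {K V : Type*} [Field K] [IsAlgClosed K] [AddCommGroup V] [Module K V]
    [FiniteDimensional K V] {q : ℕ} (hq : 1 < q) {σ : K →+* K} (hσ : ∀ a, σ a = a ^ q)
    (T : V →ₛₗ[σ] V) (c : V) : ∃ y, y - T y = c := by
  -- The spans of the first m iterates of `c` stabilize, which gives a relation T^m c = ∑_{i<m}
  -- μᵢT^i c.
  let S : ℕ →o Submodule K V :=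
    ⟨fun m => Submodule.span K (Set.range fun i : Fin m => T^[i] c), fun m n h =>
      Submodule.span_mono (by rintro _ ⟨i, rfl⟩; exact ⟨Fin.castLE h i, rfl⟩)⟩
  obtain ⟨m, hm⟩ := monotone_stabilizes_iff_noetherian.2 inferInstance S
  have h1 : T^[m] c ∈ S m := by
    rw [hm (m + 1) (Nat.le_succ m)]
    exact Submodule.subset_span ⟨Fin.last m, rfl⟩
  obtain ⟨μ', hμ'⟩ := (Submodule.mem_span_range_iff_exists_fun K).1 h1
  obtain ⟨μ, hμ⟩ : ∃ μ : ℕ → K, ∑ i ∈ Finset.range m, μ i • T^[i] c = T^[m] c := by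
    refine ⟨fun i => if h : i < m then μ' ⟨i, h⟩ else 0, ?_⟩
    rw [← hμ', Finset.sum_range]
    simp
  rcases m with _ | k
  · obtain rfl : c = 0 := by simpa using hμ.symm
    exact ⟨0, by simp⟩
  -- Seek y = ∑_{i≤k} lᵢT^i c. After T^(k+1)c is eliminated, it suffices that l₀ = 1 + μ₀l_k^q and
  -- lᵢ₊₁ = lᵢ^q + μᵢ₊₁l_k^q. With z = l_k each lᵢ becomes the polynomial Qᵢ evaluated at z^q, and
  -- the only remaining condition is Q_k(z^q) = z.
  let Q : ℕ → Polynomial K := fun i => Nat.rec (1 + Polynomial.C (μ 0) * Polynomial.X)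
    (fun i P => P ^ q + Polynomial.C (μ (i + 1)) * Polynomial.X) i
  obtain ⟨z, hz⟩ := exists_eq_eval_expand hq (Q k)
  let l : ℕ → K := fun i => (Q i).eval (z ^ q)
  have l0 : l 0 = 1 + μ 0 * z ^ q := by simp [l, Q]
  have ls : ∀ i, l (i + 1) = l i ^ q + μ (i + 1) * z ^ q := fun i => by simp [l, Q]
  have hT : T (∑ i ∈ Finset.range (k + 1), l i • T^[i] c) =
      ∑ i ∈ Finset.range (k + 1), l i ^ q • T^[i + 1] c := by
    rw [map_sum]
    refine Finset.sum_congr rfl fun i _ => ?_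
    rw [T.map_smulₛₗ, hσ, Function.iterate_succ_apply']
  refine ⟨∑ i ∈ Finset.range (k + 1), l i • T^[i] c, ?_⟩
  rw [hT, Finset.sum_range_succ (fun i => l i ^ q • T^[i + 1] c),
    Finset.sum_range_succ' (fun i => l i • T^[i] c), show l k = z from hz, ← hμ, Finset.smul_sum,
    Finset.sum_range_succ' (fun i => z ^ q • μ i • T^[i] c), l0]
  simp only [ls, add_smul, Finset.sum_add_distrib, mul_smul, smul_comm (z ^ q), one_smul,
    Function.iterate_zero, id_eq]
  abel

/-! ### The étale algebra that solves a Frobenius-linear system. -/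

variable {A ι : Type u} [CommRing A] [Fintype ι]

/-- The equations `y_i - ∑_j b_ij y_j ^ q - c_i`. -/
noncomputable def frobEquation (q : ℕ) (b : ι → ι → A) (c : ι → A) (i : ι) : MvPolynomial ι A :=
  MvPolynomial.X i - ∑ j, MvPolynomial.C (b i j) * MvPolynomial.X j ^ q - MvPolynomial.C (c i)

/-- The universal `A`-algebra with a solution of `y_i - ∑_j b_ij y_j ^ q = c_i`. -/
abbrev FrobSolutionRing (q : ℕ) (b : ι → ι → A) (c : ι → A) : Type u :=
  MvPolynomial ι A ⧸ Ideal.span (Set.range (frobEquation q b c))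

namespace FrobSolutionRing

variable {q : ℕ} {b : ι → ι → A} {c : ι → A}

variable (q b c) in
/-- The universal solution. -/
noncomputable def sol (i : ι) : FrobSolutionRing q b c := Ideal.Quotient.mk _ (MvPolynomial.X i)

lemma sol_sub (i : ι) : sol q b c i - ∑ j, algebraMap A _ (b i j) * sol q b c j ^ q =
    algebraMap A _ (c i) := by
  have h : Ideal.Quotient.mk (Ideal.span (Set.range (frobEquation q b c))) (frobEquation q b c i)
      = 0 := Ideal.Quotient.eq_zero_iff_mem.2 (Ideal.subset_span ⟨i, rfl⟩)
  rw [frobEquation, map_sub, sub_eq_zero, map_sub, map_sum] at h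
  simp only [map_mul, map_pow] at h
  exact h

/-- The universal property. -/
noncomputable def lift {C : Type*} [CommRing C] [Algebra A C] (y : ι → C)
    (hy : ∀ i, y i - ∑ j, algebraMap A C (b i j) * y j ^ q = algebraMap A C (c i)) :
    FrobSolutionRing q b c →ₐ[A] C :=
  Ideal.Quotient.liftₐ _ (MvPolynomial.aeval y) fun a ha => by
    have : Ideal.span (Set.range (frobEquation q b c)) ≤ RingHom.ker (MvPolynomial.aeval y) := by
      rw [Ideal.span_le]
      rintro _ ⟨i, rfl⟩
      have := hy i
      simpa [frobEquation, sub_eq_zero] using this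
    exact this ha

@[simp]
lemma lift_sol {C : Type*} [CommRing C] [Algebra A C] (y : ι → C)
    (hy : ∀ i, y i - ∑ j, algebraMap A C (b i j) * y j ^ q = algebraMap A C (c i)) (i : ι) :
    lift y hy (sol q b c i) = y i :=
  MvPolynomial.aeval_X _ _

lemma algHom_ext {C : Type*} [CommRing C] [Algebra A C] {f g : FrobSolutionRing q b c →ₐ[A] C}
    (h : ∀ i, f (sol q b c i) = g (sol q b c i)) : f = g :=
  Ideal.Quotient.algHom_ext _ (MvPolynomial.algHom_ext h)

lemma map_sol {C : Type*} [CommRing C] [Algebra A C] (f : FrobSolutionRing q b c →ₐ[A] C) (i : ι) :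
    f (sol q b c i) - ∑ j, algebraMap A C (b i j) * f (sol q b c j) ^ q = algebraMap A C (c i) := by
  have := congrArg f (sol_sub (q := q) (b := b) (c := c) i)
  simpa using this

/-- Modulo p only x^q and h^q survive, and h^q vanishes since q ≥ 2. This is the vanishing of the
derivative of the q-power map. -/
lemma add_pow_of_sq_eq_zero {C : Type*} [CommRing C] {p r : ℕ} (hp : p.Prime) (hr : 0 < r)
    (hC : (p : C) = 0) (x h : C) (hh : h ^ 2 = 0) : (x + h) ^ (p ^ r) = x ^ (p ^ r) := by
  obtain ⟨d, hd⟩ := exists_add_pow_prime_pow_eq hp x h r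
  have h2 : 2 ≤ p ^ r := (Nat.one_lt_pow hr.ne' hp.one_lt)
  rw [hd, hC, pow_eq_zero_of_le h2 hh]
  simp

/-- Modulo a square-zero ideal I, the q-th powers depend only on residue classes. Hence the
equations determine each yᵢ from the classes of the yⱼ, and subtracting from an arbitrary lift its
error `h` gives an exact solution in one Newton step. -/
lemma formallyEtale {p r : ℕ} (hp : p.Prime) (hr : 0 < r) (hA : (p : A) = 0) :
    Algebra.FormallyEtale A (FrobSolutionRing (p ^ r) b c) := by
  rw [Algebra.FormallyEtale.iff_comp_bijective]
  intro C _ _ I hI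
  have hC : (p : C) = 0 := by rw [← map_natCast (algebraMap A C), hA, map_zero]
  have hsq : ∀ x ∈ I, x ^ 2 = 0 := fun x hx => by
    have := Ideal.pow_mem_pow hx 2
    rwa [hI] at this
  constructor
  · intro f g hfg
    refine algHom_ext fun i => ?_
    have hd : ∀ j, f (sol _ b c j) - g (sol _ b c j) ∈ I := fun j =>
      Ideal.Quotient.eq.1 (AlgHom.congr_fun hfg (sol _ b c j))
    have hpow : ∀ j, f (sol _ b c j) ^ (p ^ r) = g (sol _ b c j) ^ (p ^ r) := fun j => by
      rw [← add_pow_of_sq_eq_zero hp hr hC (g (sol _ b c j)) _ (hsq _ (hd j)), add_sub_cancel]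
    have h1 := map_sol f i
    rw [← map_sol g i] at h1
    simp only [hpow] at h1
    exact sub_left_injective h1
  · intro f
    choose Y hY using fun i => Ideal.Quotient.mk_surjective (f (sol _ b c i))
    let h : ι → C := fun i =>
      Y i - ∑ j, algebraMap A C (b i j) * Y j ^ (p ^ r) - algebraMap A C (c i)
    have hh : ∀ i, h i ∈ I := fun i => by
      rw [← Ideal.Quotient.eq_zero_iff_mem]
      have := map_sol f i
      simp only [h, map_sub, map_sum, map_mul, map_pow, hY]
      rw [sub_eq_zero]
      exact this
    have hpow : ∀ j, (Y j - h j) ^ (p ^ r) = Y j ^ (p ^ r) := fun j => by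
      rw [sub_eq_add_neg]
      exact add_pow_of_sq_eq_zero hp hr hC _ _ (hsq _ (I.neg_mem (hh j)))
    refine ⟨lift (fun i => Y i - h i) fun i => ?_, algHom_ext fun i => ?_⟩
    · simp only [hpow]
      simp only [h]
      ring
    · have : Ideal.Quotient.mk I (Y i - h i) = f (sol _ b c i) := by
        rw [map_sub, hY, Ideal.Quotient.eq_zero_iff_mem.2 (hh i), sub_zero]
      simpa using this

lemma etale {p r : ℕ} (hp : p.Prime) (hr : 0 < r) (hA : (p : A) = 0) :
    Algebra.Etale A (FrobSolutionRing (p ^ r) b c) where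
  formallyEtale := formallyEtale hp hr hA
  finitePresentation := Algebra.FinitePresentation.quotient
    ⟨(Set.finite_range (frobEquation (p ^ r) b c)).toFinset, by simp⟩

/-- A point of the fibre over `x` comes from a solution in an algebraic closure of the residue
field, where 1 - T is surjective. -/
lemma comap_surjective {p r : ℕ} (hp : p.Prime) (hr : 0 < r) (hA : (p : A) = 0) :
    Function.Surjective (PrimeSpectrum.comap (algebraMap A (FrobSolutionRing (p ^ r) b c))) := by
  intro x
  let K := AlgebraicClosure x.asIdeal.ResidueField
  let φ : A →+* K := (algebraMap x.asIdeal.ResidueField K).comp (algebraMap A _)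
  let _ : Algebra A K := φ.toAlgebra
  have hK : (p : K) = 0 := by rw [← map_natCast φ, hA, map_zero]
  have : CharP K p := (CharP.charP_iff_prime_eq_zero hp).2 hK
  have : Fact p.Prime := ⟨hp⟩
  have : ExpChar K p := .prime hp
  let σ : K →+* K := iterateFrobenius K p r
  let T : (ι → K) →ₛₗ[σ] (ι → K) :=
    { toFun := fun y i => ∑ j, φ (b i j) * y j ^ (p ^ r)
      map_add' := fun y z => by
        ext i
        simp [add_pow_char_pow, mul_add, Finset.sum_add_distrib]
      map_smul' := fun a y => by
        ext i
        simp only [Pi.smul_apply, smul_eq_mul, mul_pow, σ, iterateFrobenius_def]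
        rw [Finset.mul_sum]
        exact Finset.sum_congr rfl fun j _ => mul_left_comm _ _ _ }
  obtain ⟨y, hy⟩ := exists_sub_semilinear_eq (Nat.one_lt_pow hr.ne' hp.one_lt)
    (fun a => iterateFrobenius_def p r a) T (fun i => φ (c i))
  let f : FrobSolutionRing (p ^ r) b c →ₐ[A] K := lift y fun i => congrFun hy i
  refine ⟨⟨RingHom.ker f, RingHom.ker_isPrime _⟩, ?_⟩
  ext a
  change f (algebraMap A _ a) = 0 ↔ _
  rw [f.commutes]
  change algebraMap x.asIdeal.ResidueField K (algebraMap A _ a) = 0 ↔ _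
  rw [map_eq_zero, Ideal.algebraMap_residueField_eq_zero]

end FrobSolutionRing

end Algebra

/-! ### Covers of the small étale site and étale coordinates. -/

section Site

variable {X : Scheme.{u}}

lemma mem_smallEtaleTopology_iff {U : X.Etale} (S : Sieve U) :
    S ∈ X.smallEtaleTopology U ↔
      ∀ x : U.left, ∃ (V : X.Etale) (f : V ⟶ U) (y : V.left), S f ∧ f.left y = x := by
  let ι := Σ V : X.Etale, {f : V ⟶ U // S f}
  have h : S = Sieve.ofArrows (fun i : ι => i.1) (fun i => i.2.1) := by
    ext V f
    refine ⟨fun hf => Sieve.ofArrows_mk _ _ (⟨V, f, hf⟩ : ι), ?_⟩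
    rintro ⟨_, g, _, ⟨i⟩, rfl⟩
    exact S.downward_closed i.2.2 g
  conv_lhs => rw [h]
  rw [Scheme.ofArrows_mem_smallEtaleTopology_iff, Set.eq_univ_iff_forall]
  refine forall_congr' fun x => ?_
  simp only [Set.mem_iUnion, Set.mem_range]
  constructor
  · rintro ⟨i, y, e⟩
    exact ⟨i.1, i.2.1, y, i.2.2, e⟩
  · rintro ⟨V, f, y, h, e⟩
    exact ⟨⟨V, f, h⟩, y, e⟩

/-- An étale scheme over an étale `X`-scheme, as an étale `X`-scheme. -/
noncomputable abbrev etaleOver (U : X.Etale) {W : Scheme.{u}} (f : W ⟶ U.left) [Etale f] :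
    X.Etale := Scheme.Etale.mk (f ≫ U.hom)

/-- The structural morphism of `etaleOver U f`. -/
noncomputable abbrev etaleOverHom (U : X.Etale) {W : Scheme.{u}} (f : W ⟶ U.left) [Etale f] :
    etaleOver U f ⟶ U := MorphismProperty.Over.homMk f rfl

/-- `V` is affine and étale over the affine line over `k`. -/
structure IsGood (k : Type u) [Field k] (V : X.Etale) : Prop where
  isAffine : IsAffine V.left
  exists_etale : ∃ g : MvPolynomial (Fin 1) k →+* (etaleO X).obj (op V), g.Etale

/-- The composite `U → X → Spec k` is again smooth of relative dimension 1, so it is locally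
standard smooth and factors through an étale map to the affine line. -/
lemma exists_isGood {k : Type u} [Field k] (π : X ⟶ Spec (.of k))
    [SmoothOfRelativeDimension 1 π] (U : X.Etale) (x : U.left) :
    ∃ (V : X.Etale) (f : V ⟶ U) (y : V.left), IsGood k V ∧ f.left y = x := by
  have : Etale U.hom := U.prop
  have h : SmoothOfRelativeDimension (0 + 1) (U.hom ≫ π) := inferInstance
  obtain ⟨S, hS, W, hW, hx, e, hg⟩ := h.exists_isStandardSmoothOfRelativeDimension x
  obtain ⟨g, -, hg⟩ := hg.exists_etale_mvPolynomial
  -- The spectrum of a field has one point, so the open subset of the base in the chart is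
  -- everything.
  have hS' : S = ⊤ := by
    ext y
    have hy : (U.hom ≫ π) x ∈ S := e hx
    have : y = (U.hom ≫ π) x := Subsingleton.elim (α := PrimeSpectrum k) _ _
    simpa [this] using hy
  subst hS'
  let ε : k ≃+* Γ(Spec (.of k), ⊤) := (Scheme.ΓSpecIso (.of k)).symm.commRingCatIsoToRingEquiv
  let g' : MvPolynomial (Fin 1) k →+* Γ(U.left, W) :=
    g.comp (MvPolynomial.mapEquiv (Fin 1) ε).toRingHom
  have hg' : g'.Etale := RingHom.Etale.stableUnderComposition _ _
    (RingHom.Etale.of_bijective (MvPolynomial.mapEquiv (Fin 1) ε).bijective) hg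
  let η : Γ(U.left, W) ≃+* Γ(W.toScheme, ⊤) := W.topIso.symm.commRingCatIsoToRingEquiv
  refine ⟨etaleOver U W.ι, etaleOverHom U W.ι, ⟨x, hx⟩, ⟨hW, η.toRingHom.comp g', ?_⟩, rfl⟩
  exact RingHom.Etale.stableUnderComposition _ _ hg' (RingHom.Etale.of_bijective η.bijective)

lemma exists_isAffine (U : X.Etale) (x : U.left) :
    ∃ (V : X.Etale) (f : V ⟶ U) (y : V.left), IsAffine V.left ∧ f.left y = x := by
  obtain ⟨_, ⟨(W : U.left.Opens), hW, rfl⟩, hx, -⟩ :=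
    U.left.isBasis_affineOpens.exists_subset_of_mem_open (Set.mem_univ x) isOpen_univ
  exact ⟨etaleOver U W.ι, etaleOverHom U W.ι, ⟨x, hx⟩, hW, rfl⟩

/-- If sufficiently many étale schemes have the property `P`, then the morphisms which factor
through them form a covering sieve. -/
lemma exists_mem_smallEtaleTopology {U : X.Etale} {P : ∀ V : X.Etale, (V ⟶ U) → Prop}
    (h : ∀ x : U.left, ∃ (V : X.Etale) (f : V ⟶ U) (y : V.left), P V f ∧ f.left y = x) :
    ∃ S ∈ X.smallEtaleTopology U, ∀ ⦃V : X.Etale⦄ (f : V ⟶ U), S f →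
      ∃ (W : X.Etale) (g : V ⟶ W) (f' : W ⟶ U), P W f' ∧ g ≫ f' = f := by
  refine ⟨Sieve.generate fun V f => P V f, ?_, ?_⟩
  · rw [mem_smallEtaleTopology_iff]
    intro x
    obtain ⟨V, f, y, hP, e⟩ := h x
    exact ⟨V, f, y, Sieve.le_generate _ _ _ hP, e⟩
  · rintro V f ⟨W, g, f', hP, e⟩
    exact ⟨W, g, f', hP, e⟩

/-- Two sections of the structure sheaf agree if they agree on sufficiently many étale schemes. -/
lemma etaleO_ext' {U : X.Etale} {P : ∀ V : X.Etale, (V ⟶ U) → Prop}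
    (h : ∀ x : U.left, ∃ (V : X.Etale) (f : V ⟶ U) (y : V.left), P V f ∧ f.left y = x)
    {a b : (etaleO X).obj (op U)}
    (hab : ∀ (V : X.Etale) (f : V ⟶ U), P V f → (etaleO X).map f.op a = (etaleO X).map f.op b) :
    a = b := by
  obtain ⟨S, hS, hSP⟩ := exists_mem_smallEtaleTopology h
  refine etaleO_ext hS fun V f hf => ?_
  obtain ⟨W, g, f', hP, rfl⟩ := hSP f hf
  rw [op_comp, Functor.map_comp, CommRingCat.comp_apply, CommRingCat.comp_apply, hab W f' hP]

end Site
-- Homomorphisms into the structure sheaf glued from relations.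
section Glueing

variable {X : Scheme.{u}}

lemma etaleO_map_comp {U V W : X.Etale} (g : W ⟶ V) (f : V ⟶ U) (s : (etaleO X).obj (op U)) :
    (etaleO X).map (g ≫ f).op s = (etaleO X).map g.op ((etaleO X).map f.op s) := by
  rw [op_comp, Functor.map_comp]
  rfl

lemma restr_comp (P : EtPMod X) {U V W : X.Etale} (g : W ⟶ V) (f : V ⟶ U) (m : P.obj (op U)) :
    restr P (g ≫ f) m = restr P g (restr P f m) :=
  P.map_comp_apply f.op g.op m

lemma SingleValued.eq {A M L : Type*} [CommRing A] [AddCommGroup M] [AddCommGroup L] [Module A M]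
    [Module A L] {R : Submodule A (M × L)} (hR : SingleValued R) {m : M} {s t : L}
    (hs : (m, s) ∈ R) (ht : (m, t) ∈ R) : s = t := by
  have := R.sub_mem hs ht
  rw [Prod.mk_sub_mk, sub_self] at this
  exact sub_eq_zero.1 (hR _ this)

/-- For every étale `V → U` a relation between `P(V)` and `O(V)`. -/
abbrev RelationFamily (P : EtPMod X) (U : X.Etale) :=
  ∀ ⦃V : X.Etale⦄ (_ : V ⟶ U), Submodule ((etaleO X).obj (op V))
    (P.obj (op V) × (etaleO X).obj (op V))

namespace RelationFamily

variable {P : EtPMod X} {U : X.Etale}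

/-- The relations are stable under restriction. -/
def IsStable (R : RelationFamily P U) : Prop :=
  ∀ ⦃V W : X.Etale⦄ (f : V ⟶ U) (g : W ⟶ V) (m : P.obj (op V)) (s : (etaleO X).obj (op V)),
    (m, s) ∈ R f → (restr P g m, (etaleO X).map g.op s) ∈ R (g ≫ f)

/-- Locally every section is related to some function. -/
def IsLocallyTotal (R : RelationFamily P U) : Prop :=
  ∀ ⦃V : X.Etale⦄ (f : V ⟶ U) (m : P.obj (op V)), ∃ S ∈ X.smallEtaleTopology V,
    ∀ ⦃W : X.Etale⦄ (g : W ⟶ V), S g → ∃ s, (restr P g m, s) ∈ R (g ≫ f)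

/-- A stable, locally total family of single-valued relations is contained in the graph of a
homomorphism. -/
lemma exists_homFamily (R : RelationFamily P U) (h1 : R.IsStable)
    (h2 : ∀ ⦃V : X.Etale⦄ (f : V ⟶ U), SingleValued (R f)) (h3 : R.IsLocallyTotal) :
    ∃ t : homFamilies P (linearMaps P) U, ∀ ⦃V : X.Etale⦄ (f : V ⟶ U) (m : P.obj (op V))
      (s : (etaleO X).obj (op V)), (m, s) ∈ R f → t.1 f m = s := by
  -- Locally chosen values agree on overlaps, since both are related to the same section there and
  -- the relation is single-valued. The glued value then agrees with every related function, not
  -- only with the chosen ones.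
  have key : ∀ ⦃V : X.Etale⦄ (f : V ⟶ U) (m : P.obj (op V)), ∃ t : (etaleO X).obj (op V),
      ∀ ⦃W : X.Etale⦄ (g : W ⟶ V) (s : (etaleO X).obj (op W)), (restr P g m, s) ∈ R (g ≫ f) →
        (etaleO X).map g.op t = s := by
    intro V f m
    obtain ⟨S, hS, h⟩ := h3 f m
    choose s hs using h
    obtain ⟨t, ht, -⟩ := isSheaf_etaleO_forget X S hS (fun W g hg => s g hg) (by
      intro W₁ W₂ Z g₁ g₂ f₁ f₂ k₁ k₂ e
      have e1 := h1 _ g₁ _ _ (hs f₁ k₁)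
      have e2 := h1 _ g₂ _ _ (hs f₂ k₂)
      rw [← restr_comp, ← Category.assoc] at e1 e2
      rw [← e] at e2
      exact (h2 _).eq e1 e2)
    refine ⟨t, fun W g s' hs' => ?_⟩
    refine etaleO_ext (X.smallEtaleTopology.pullback_stable g hS) fun Z g' hg' => ?_
    have e1 := hs _ hg'
    have e2 := h1 _ g' _ _ hs'
    rw [← restr_comp, ← Category.assoc] at e2
    rw [← etaleO_map_comp, ← (h2 _).eq e1 e2]
    exact ht (g' ≫ g) hg'
  choose t ht using key
  have ext : ∀ ⦃V : X.Etale⦄ (f : V ⟶ U) (m : P.obj (op V)) (s : (etaleO X).obj (op V)),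
      (∀ ⦃W : X.Etale⦄ (g : W ⟶ V) (s' : (etaleO X).obj (op W)), (restr P g m, s') ∈ R (g ≫ f) →
        (etaleO X).map g.op s = s') → t f m = s := by
    intro V f m s h
    obtain ⟨S, hS, h'⟩ := h3 f m
    refine etaleO_ext hS fun W g hg => ?_
    obtain ⟨s', hs'⟩ := h' g hg
    rw [h g s' hs', ht f m g s' hs']
  let φ : ∀ ⦃V : X.Etale⦄ (_ : V ⟶ U), P.obj (op V) →+ (etaleO X).obj (op V) := fun V f =>
    AddMonoidHom.mk' (t f) fun a b => by
      obtain ⟨S, hS, h⟩ := h3 f a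
      obtain ⟨S', hS', h'⟩ := h3 f b
      refine etaleO_ext (X.smallEtaleTopology.intersection_covering hS hS') fun W g hg => ?_
      obtain ⟨x, hx⟩ := h g hg.1
      obtain ⟨y, hy⟩ := h' g hg.2
      rw [map_add, ht f a g x hx, ht f b g y hy]
      refine ht f _ g _ ?_
      rw [map_add]
      exact (R (g ≫ f)).add_mem hx hy
  refine ⟨⟨φ, fun V f a m => ?_, fun V W f g m => ?_⟩, fun V f m s hs => ?_⟩
  · obtain ⟨S, hS, h⟩ := h3 f m
    refine etaleO_ext hS fun W g hg => ?_
    obtain ⟨x, hx⟩ := h g hg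
    rw [map_mul]
    change _ = _ * (etaleO X).map g.op (t f m)
    rw [ht f m g x hx]
    refine ht f _ g _ ?_
    rw [(restr P g).map_smulₛₗ]
    exact (R (g ≫ f)).smul_mem _ hx
  · refine ext _ _ _ fun W' g' s hs => ?_
    rw [← etaleO_map_comp]
    refine ht f m (g' ≫ g) s ?_
    rw [restr_comp, Category.assoc]
    exact hs
  · refine ext _ _ _ fun W g s' hs' => ?_
    exact (h2 _).eq (h1 f g m s hs) hs'

end RelationFamily

/-- Let `T V ⊆ P(V)` be sets of sections which generate `P` locally. Two families of linear maps
which agree on these sections are equal. -/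
lemma homFamilies_ext {P : EtPMod X} {U : X.Etale} {t t' : homFamilies P (linearMaps P) U}
    (T : ∀ V : X.Etale, (V ⟶ U) → Set (P.obj (op V)))
    (hT : ∀ ⦃V : X.Etale⦄ (f : V ⟶ U) (m : P.obj (op V)), ∃ S ∈ X.smallEtaleTopology V,
      ∀ ⦃W : X.Etale⦄ (g : W ⟶ V), S g →
        restr P g m ∈ Submodule.span ((etaleO X).obj (op W)) (T W (g ≫ f)))
    (h : ∀ ⦃V : X.Etale⦄ (f : V ⟶ U) (m : P.obj (op V)), m ∈ T V f → t.1 f m = t'.1 f m) :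
    t = t' := by
  refine Subtype.ext ?_
  funext V f
  refine AddMonoidHom.ext fun m => ?_
  obtain ⟨S, hS, hm⟩ := hT f m
  refine etaleO_ext hS fun W g hg => ?_
  rw [← t.2.2, ← t'.2.2]
  refine Submodule.span_induction (h _) ?_ ?_ ?_ (hm g hg)
  · rw [map_zero, map_zero]
  · intro x y _ _ hx hy
    rw [map_add, map_add, hx, hy]
  · intro a x _ hx
    rw [t.2.1, t'.2.1, hx]

end Glueing
-- Relations that hold étale locally.
section Localize

variable {X : Scheme.{u}} {P : EtPMod X} {U : X.Etale}

namespace RelationFamily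

lemma exists_of_mem_span {V W : X.Etale} (g : W ⟶ V)
    {T : Set (P.obj (op V) × (etaleO X).obj (op V))}
    {R : Submodule ((etaleO X).obj (op W)) (P.obj (op W) × (etaleO X).obj (op W))}
    (h : ∀ z ∈ T, (restr P g z.1, (etaleO X).map g.op z.2) ∈ R)
    {z : P.obj (op V) × (etaleO X).obj (op V)}
    (hz : z ∈ Submodule.span ((etaleO X).obj (op V)) T) :
    (restr P g z.1, (etaleO X).map g.op z.2) ∈ R := by
  refine Submodule.span_induction h ?_ ?_ ?_ hz
  · rw [Prod.fst_zero, Prod.snd_zero, map_zero, map_zero]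
    exact R.zero_mem
  · intro x y _ _ hx hy
    rw [Prod.fst_add, Prod.snd_add, map_add, map_add]
    exact R.add_mem hx hy
  · intro a x _ hx
    rw [Prod.smul_fst, Prod.smul_snd, (restr P g).map_smulₛₗ, smul_eq_mul, map_mul]
    exact R.smul_mem _ hx

/-- The pairs of sections which are locally related. -/
noncomputable def localize (R : RelationFamily P U) : RelationFamily P U := fun V f =>
  { carrier := {z | ∃ S ∈ X.smallEtaleTopology V, ∀ ⦃W : X.Etale⦄ (g : W ⟶ V), S g →
      (restr P g z.1, (etaleO X).map g.op z.2) ∈ R (g ≫ f)}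
    zero_mem' := ⟨⊤, X.smallEtaleTopology.top_mem V, fun W g _ => by
      rw [Prod.fst_zero, Prod.snd_zero, map_zero, map_zero]
      exact (R (g ≫ f)).zero_mem⟩
    add_mem' := by
      rintro x y ⟨S, hS, hx⟩ ⟨S', hS', hy⟩
      refine ⟨S ⊓ S', X.smallEtaleTopology.intersection_covering hS hS', fun W g hg => ?_⟩
      rw [Prod.fst_add, Prod.snd_add, map_add, map_add]
      exact (R (g ≫ f)).add_mem (hx g hg.1) (hy g hg.2)
    smul_mem' := by
      rintro a x ⟨S, hS, hx⟩
      refine ⟨S, hS, fun W g hg => ?_⟩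
      rw [Prod.smul_fst, Prod.smul_snd, (restr P g).map_smulₛₗ, smul_eq_mul, map_mul]
      exact (R (g ≫ f)).smul_mem _ (hx g hg) }

variable {R : RelationFamily P U}

lemma IsStable.le_localize (h : R.IsStable) ⦃V : X.Etale⦄ (f : V ⟶ U) : R f ≤ R.localize f :=
  fun z hz => ⟨⊤, X.smallEtaleTopology.top_mem V, fun _ g _ => h f g z.1 z.2 hz⟩

lemma localize_isStable (R : RelationFamily P U) : R.localize.IsStable := by
  rintro V W f g m s ⟨S, hS, h⟩
  refine ⟨S.pullback g, X.smallEtaleTopology.pullback_stable g hS, fun Z g' hg' => ?_⟩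
  have := h (g' ≫ g) hg'
  rwa [restr_comp, etaleO_map_comp, Category.assoc] at this

/-- Localizing twice adds nothing: composing a cover with covers of its members gives a cover. -/
lemma localize_le {R' : RelationFamily P U} (h : ∀ ⦃V : X.Etale⦄ (f : V ⟶ U), R f ≤ R'.localize f)
    ⦃V : X.Etale⦄ (f : V ⟶ U) : R.localize f ≤ R'.localize f := by
  rintro z ⟨S, hS, hz⟩
  choose T hT hz' using fun (W : X.Etale) (g : W ⟶ V) (hg : S g) => h _ (hz g hg)
  refine ⟨Sieve.bind S fun W g hg => T W g hg,
    X.smallEtaleTopology.bind_covering hS fun W g hg => hT W g hg, ?_⟩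
  rintro W _ ⟨Z, g', g, hg, hg', rfl⟩
  have := hz' Z g hg g' hg'
  rwa [← restr_comp, ← etaleO_map_comp, ← Category.assoc] at this

lemma singleValued_localize (h : ∀ ⦃V : X.Etale⦄ (f : V ⟶ U), SingleValued (R f)) ⦃V : X.Etale⦄
    (f : V ⟶ U) : SingleValued (R.localize f) := by
  rintro s ⟨S, hS, hs⟩
  refine etaleO_ext hS fun W g hg => ?_
  have := hs g hg
  rw [map_zero] at this
  rw [map_zero, h _ _ this]

end RelationFamily

end Localize

namespace FrobeniusModule

/-! ### Frobenius iterates of the graph of a homomorphism. -/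

section Relations

variable {X : Scheme.{u}} {q : ℕ} (M : FrobeniusModule X q) {N : M.val.Submodule} {U : X.Etale}

/-- The relations between `x ∈ M` and `a ∈ O` generated by the pairs `(F^i x, φ(x) ^ (q ^ i))` for
`x` in the submodule `N`. -/
noncomputable def frobRel (φ : homFamilies N.toPresheafOfModules (linearMaps N.toPresheafOfModules) U) :
    ℕ → RelationFamily M.val U
  | 0 => fun V f =>
    { carrier := {z | ∃ x : N.obj (op V), z = (x.1, φ.1 f x)}
      zero_mem' := ⟨0, Prod.ext rfl (φ.1 f).map_zero.symm⟩
      add_mem' := by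
        rintro _ _ ⟨x, rfl⟩ ⟨y, rfl⟩
        exact ⟨x + y, Prod.ext rfl ((φ.1 f).map_add x y).symm⟩
      smul_mem' := by
        rintro a _ ⟨x, rfl⟩
        exact ⟨a • x, Prod.ext rfl (φ.2.1 f a x).symm⟩ }
  | i + 1 => fun V f => Submodule.span _
      ((fun z : M.val.obj (op V) × (etaleO X).obj (op V) => (M.F V z.1, z.2 ^ q)) ''
        frobRel φ i f)

variable {M} (φ : homFamilies N.toPresheafOfModules (linearMaps N.toPresheafOfModules) U)

lemma mem_frobRel_zero {V : X.Etale} (f : V ⟶ U) (x : N.obj (op V)) :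
    (x.1, φ.1 f x) ∈ M.frobRel φ 0 f := ⟨x, rfl⟩

lemma mem_frobRel_succ {i : ℕ} {V : X.Etale} {f : V ⟶ U} {m : M.val.obj (op V)}
    {s : (etaleO X).obj (op V)} (h : (m, s) ∈ M.frobRel φ i f) :
    (M.F V m, s ^ q) ∈ M.frobRel φ (i + 1) f :=
  Submodule.subset_span ⟨_, h, rfl⟩

lemma exists_mem_frobRel (i : ℕ) {V : X.Etale} (f : V ⟶ U) (x : N.obj (op V)) :
    ∃ s, ((M.F V)^[i] x.1, s) ∈ M.frobRel φ i f := by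
  induction i with
  | zero => exact ⟨_, mem_frobRel_zero φ f x⟩
  | succ i ih =>
    obtain ⟨s, hs⟩ := ih
    refine ⟨s ^ q, ?_⟩
    rw [Function.iterate_succ_apply']
    exact mem_frobRel_succ φ hs

lemma sum_mem_frobRel_one {V : X.Etale} (f : V ⟶ U) {n : ℕ} (a : Fin n → (etaleO X).obj (op V))
    (x : Fin n → N.obj (op V)) :
    (∑ i, a i • M.F V (x i).1, ∑ i, a i * φ.1 f (x i) ^ q) ∈ M.frobRel φ 1 f := by
  rw [prod_mk_sum]
  exact Submodule.sum_mem _ fun i _ => Submodule.smul_mem _ (a i)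
    (mem_frobRel_succ φ (mem_frobRel_zero φ f (x i)))

lemma frobRel_isStable (i : ℕ) : (M.frobRel φ i).IsStable := by
  induction i with
  | zero =>
    rintro V W f g _ _ ⟨x, ⟨⟩⟩
    refine ⟨restr N.toPresheafOfModules g x, ?_⟩
    rw [← φ.2.2 f g x]
    rfl
  | succ i ih =>
    intro V W f g m s h
    refine RelationFamily.exists_of_mem_span g ?_ h
    rintro _ ⟨z, hz, rfl⟩
    have := mem_frobRel_succ φ (ih f g z.1 z.2 hz)
    rw [map_pow]
    have h := M.F_restr g z.1
    change M.F W (restr M.val g z.1) = restr M.val g (M.F V z.1) at h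
    rwa [h] at this

end Relations

/-! ### Single-valuedness over étale coordinates. -/

section Unit

variable {k : Type u} [Field k] {X : Scheme.{u}} (π : X ⟶ Spec (.of k)) {p r : ℕ} [Fact p.Prime]
  [CharP k p] {M : FrobeniusModule X (p ^ r)} {N : M.val.Submodule} {U : X.Etale}
  (φ : homFamilies N.toPresheafOfModules (linearMaps N.toPresheafOfModules) U)

/-- Level 0 is the graph of `φ`. Each further level is the base change of the previous one along the
flat q-power map, because `M` is unit. -/
lemma frobRel_singleValued_of_isGood (hM : M.IsUnit π) (i : ℕ) {V : X.Etale} (hV : IsGood k V)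
    (f : V ⟶ U) : SingleValued (M.frobRel φ i f) := by
  induction i with
  | zero =>
    rintro s ⟨x, hx⟩
    obtain ⟨h1, h2⟩ := Prod.ext_iff.1 hx
    obtain rfl : x = 0 := Subtype.ext h1.symm
    exact h2.trans (map_zero _)
  | succ i ih =>
    obtain ⟨g, hg⟩ := hV.exists_etale
    let G : (etaleO X).obj (op V) →ₛₗ[frobPow π p r V] (etaleO X).obj (op V) :=
      { toFun := frobPow π p r V
        map_add' := map_add _
        map_smul' := fun a b => map_mul (frobPow π p r V) a b }
    exact SingleValued.span_image (flat_of_etale_of_pow hg fun _ => rfl) (hM.2 V hV.isAffine) G ih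

end Unit

/-! ### Uniqueness of the Frobenius on the dual, and its fixed points. -/

section DualFrobenius

variable {X : Scheme.{u}} {q : ℕ} {M : FrobeniusModule X q} {N : M.val.Submodule}
  {U : X.Etale}

/-- `ψ` is the image of `φ` under the action of `F^r` on `Hom_{O_X}(N, O_X)`. -/
def IsFrobeniusOf (φ ψ : homFamilies N.toPresheafOfModules (linearMaps N.toPresheafOfModules) U) :
    Prop :=
  ∀ ⦃V : X.Etale⦄ (f : V ⟶ U) (n : ℕ) (a : Fin n → (etaleO X).obj (op V))
    (x : Fin n → N.obj (op V)) (m : N.obj (op V)),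
    m.1 = ∑ i, a i • M.F V (x i).1 → ψ.1 f m = ∑ i, a i * φ.1 f (x i) ^ q

lemma exists_eq_sum {V : X.Etale} {m : M.val.obj (op V)}
    (hm : m ∈ Submodule.span ((etaleO X).obj (op V)) (M.F V '' {n | n ∈ N.obj (op V)})) :
    ∃ (n : ℕ) (a : Fin n → (etaleO X).obj (op V)) (x : Fin n → N.obj (op V)),
      m = ∑ i, a i • M.F V (x i).1 := by
  obtain ⟨n, a, x, rfl⟩ := Submodule.mem_span_set'.1 hm
  choose y hy hyx using fun i => (x i).2
  exact ⟨n, a, fun i => ⟨y i, hy i⟩, Finset.sum_congr rfl fun i _ => by rw [hyx]⟩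

/-- Locally every section of a root is a linear combination of elements `F x`. -/
lemma IsRoot.exists_eq_sum (hN : M.IsRoot N) {V : X.Etale} (m : N.obj (op V)) :
    ∃ S ∈ X.smallEtaleTopology V, ∀ ⦃W : X.Etale⦄ (g : W ⟶ V), S g →
      ∃ (n : ℕ) (a : Fin n → (etaleO X).obj (op W)) (x : Fin n → N.obj (op W)),
        (restr N.toPresheafOfModules g m).1 = ∑ i, a i • M.F W (x i).1 := by
  obtain ⟨S, hS, h⟩ := hN.le_span V m.1 m.2
  exact ⟨S, hS, fun W g hg => FrobeniusModule.exists_eq_sum (h g hg)⟩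

/-- The formula prescribes the value on every section of `N` that is a combination of sections F(x),
and on a root every section is locally of this form. -/
lemma IsFrobeniusOf.unique (hN : M.IsRoot N)
    {φ ψ ψ' : homFamilies N.toPresheafOfModules (linearMaps N.toPresheafOfModules) U}
    (h : IsFrobeniusOf φ ψ) (h' : IsFrobeniusOf φ ψ') : ψ = ψ' := by
  refine homFamilies_ext (fun V _ => {m | ∃ (n : ℕ) (a : Fin n → (etaleO X).obj (op V))
    (x : Fin n → N.obj (op V)), m.1 = ∑ i, a i • M.F V (x i).1}) (fun V f m => ?_) ?_
  · obtain ⟨S, hS, hm⟩ := hN.exists_eq_sum m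
    exact ⟨S, hS, fun W g hg => Submodule.subset_span (hm g hg)⟩
  · rintro V f m ⟨n, a, x, hm⟩
    exact (h f n a x m hm).trans (h' f n a x m hm).symm

lemma IsFrobeniusOf.map
    {φ ψ : homFamilies N.toPresheafOfModules (linearMaps N.toPresheafOfModules) U}
    (h : IsFrobeniusOf φ ψ) {U' : X.Etale} (g : U' ⟶ U) :
    IsFrobeniusOf
      (show homFamilies N.toPresheafOfModules (linearMaps N.toPresheafOfModules) U' from
        (dual N.toPresheafOfModules).obj.map g.op φ)
      (show homFamilies N.toPresheafOfModules (linearMaps N.toPresheafOfModules) U' from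
        (dual N.toPresheafOfModules).obj.map g.op ψ) :=
  fun _ f n a x m hm => h (f ≫ g) n a x m hm

lemma IsDualFrobenius.unique (hN : M.IsRoot N)
    {Φ Ψ : dual N.toPresheafOfModules ⟶ dual N.toPresheafOfModules} (hΦ : M.IsDualFrobenius N Φ)
    (hΨ : M.IsDualFrobenius N Ψ) : Ψ = Φ := by
  refine Sheaf.hom_ext (NatTrans.ext (funext fun U => AddCommGrpCat.hom_ext
    (AddMonoidHom.ext fun φ => ?_)))
  exact IsFrobeniusOf.unique hN (hΨ U.unop φ) (hΦ U.unop φ)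

/-- Locally the relations `frobRel φ i` increase with `i` if `φ` is fixed by `F^r`. -/
lemma frobRel_le_localize (hN : M.IsRoot N)
    {φ : homFamilies N.toPresheafOfModules (linearMaps N.toPresheafOfModules) U}
    (hφ : IsFrobeniusOf φ φ) (i : ℕ) ⦃V : X.Etale⦄ (f : V ⟶ U) :
    M.frobRel φ i f ≤ (M.frobRel φ (i + 1)).localize f := by
  induction i generalizing V with
  | zero =>
    rintro _ ⟨x, rfl⟩
    obtain ⟨S, hS, h⟩ := hN.exists_eq_sum x
    refine ⟨S, hS, fun W g hg => ?_⟩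
    obtain ⟨n, a, y, e⟩ := h g hg
    change (restr M.val g x.1, _) ∈ _
    -- Write x = ∑ aᵢF(yᵢ). As `φ` is fixed, φ(x) = ∑ aᵢφ(yᵢ)^q, so the pair lies in the first
    -- Frobenius level.
    rw [← φ.2.2 f g x, hφ (g ≫ f) n a y _ e, show restr M.val g x.1 = _ from e]
    exact sum_mem_frobRel_one φ (g ≫ f) a y
  | succ i ih =>
    refine Submodule.span_le.2 ?_
    rintro _ ⟨z, hz, rfl⟩
    obtain ⟨S, hS, h⟩ := ih f hz
    refine ⟨S, hS, fun W g hg => ?_⟩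
    have h1 := mem_frobRel_succ φ (h g hg)
    have h2 := M.F_restr g z.1
    change M.F W (restr M.val g z.1) = restr M.val g (M.F V z.1) at h2
    rwa [h2, ← map_pow] at h1

end DualFrobenius

/-! ### Existence of the dual Frobenius, and extension of fixed homomorphisms. -/

section Unit

variable {k : Type u} [Field k] {X : Scheme.{u}} (π : X ⟶ Spec (.of k)) {p r : ℕ} [Fact p.Prime]
  [CharP k p] {M : FrobeniusModule X (p ^ r)} {N : M.val.Submodule} {U : X.Etale}

lemma IsFrobeniusOf.add
    {φ ψ φ' ψ' : homFamilies N.toPresheafOfModules (linearMaps N.toPresheafOfModules) U}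
    (π : X ⟶ Spec (.of k))
    (h : IsFrobeniusOf φ ψ) (h' : IsFrobeniusOf φ' ψ') : IsFrobeniusOf (φ + φ') (ψ + ψ') := by
  intro V f n a x m hm
  change ψ.1 f m + ψ'.1 f m = ∑ i, a i * (φ.1 f (x i) + φ'.1 f (x i)) ^ (p ^ r)
  rw [h f n a x m hm, h' f n a x m hm, ← Finset.sum_add_distrib]
  refine Finset.sum_congr rfl fun i _ => ?_
  rw [← mul_add]
  exact congrArg _ (map_add (frobPow π p r V) _ _).symm

lemma iterate_eq_pow {V : X.Etale} {t : M.val.obj (op V) →+ (etaleO X).obj (op V)}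
    (ht : t ∈ frobLinearMaps π M V) (i : ℕ) (m : M.val.obj (op V)) :
    t ((M.F V)^[i] m) = t m ^ ((p ^ r) ^ i) := by
  induction i with
  | zero => simp
  | succ i ih => rw [Function.iterate_succ_apply', ht.2, ih, ← pow_mul, ← pow_succ]

/-- An `F^r`-linear map is determined by its restriction to a root. -/
lemma eq_of_restrict_eq (hN : M.IsRoot N) {t t' : homFamilies M.val (frobLinearMaps π M) U}
    (h : ∀ ⦃V : X.Etale⦄ (f : V ⟶ U) (x : N.obj (op V)), t.1 f x.1 = t'.1 f x.1) : t = t' := by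
  have := homFamilies_ext (t := ⟨t.1, fun V f => (t.2.1 f).1, t.2.2⟩)
    (t' := ⟨t'.1, fun V f => (t'.2.1 f).1, t'.2.2⟩)
    (fun V _ => ⋃ i : ℕ, (M.F V)^[i] '' {n | n ∈ N.obj (op V)})
    (fun V _ m => hN.generates V m) (by
      intro V f m hm
      obtain ⟨i, x, hx, rfl⟩ := Set.mem_iUnion.1 hm
      change t.1 f _ = t'.1 f _
      rw [iterate_eq_pow π (t.2.1 f), iterate_eq_pow π (t'.2.1 f), h f ⟨x, hx⟩])
  exact Subtype.ext (congrArg (fun z => z.1) this)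

/-- The restriction of an `F^r`-linear map to a submodule is fixed by `F^r`. -/
lemma isFrobeniusOf_restrict (t : homFamilies M.val (frobLinearMaps π M) U)
    {φ : homFamilies N.toPresheafOfModules (linearMaps N.toPresheafOfModules) U}
    (hφ : ∀ ⦃V : X.Etale⦄ (f : V ⟶ U) (x : N.obj (op V)), t.1 f x.1 = φ.1 f x) :
    IsFrobeniusOf φ φ := by
  intro V f n a x m hm
  rw [← hφ, hm, map_sum]
  refine Finset.sum_congr rfl fun i _ => ?_
  rw [(t.2.1 f).1, (t.2.1 f).2, hφ]

variable [SmoothOfRelativeDimension 1 π]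

/-- The relations restrict to the charts étale over the affine line, and these charts detect whether
a function vanishes. -/
lemma frobRel_singleValued (hM : M.IsUnit π)
    (φ : homFamilies N.toPresheafOfModules (linearMaps N.toPresheafOfModules) U) (i : ℕ)
    {V : X.Etale} (f : V ⟶ U) : SingleValued (M.frobRel φ i f) := by
  intro s hs
  refine etaleO_ext' (exists_isGood π V) fun W g hW => ?_
  have := frobRel_isStable φ i f g _ _ hs
  rw [map_zero] at this
  rw [map_zero]
  exact frobRel_singleValued_of_isGood π φ hM i hW _ _ this

/-- The graph sought is the part of `frobRel φ 1` lying over `N`; it is locally total because a root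
is contained in the span of its Frobenius image. -/
lemma exists_isFrobeniusOf (hM : M.IsUnit π) (hN : M.IsRoot N)
    (φ : homFamilies N.toPresheafOfModules (linearMaps N.toPresheafOfModules) U) :
    ∃ ψ : homFamilies N.toPresheafOfModules (linearMaps N.toPresheafOfModules) U,
      IsFrobeniusOf φ ψ := by
  let R : RelationFamily N.toPresheafOfModules U := fun V f =>
    { carrier := {z | (z.1.1, z.2) ∈ M.frobRel φ 1 f}
      zero_mem' := (M.frobRel φ 1 f).zero_mem
      add_mem' := fun hx hy => (M.frobRel φ 1 f).add_mem hx hy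
      smul_mem' := fun a _ hx => (M.frobRel φ 1 f).smul_mem a hx }
  obtain ⟨ψ, hψ⟩ := RelationFamily.exists_homFamily R
    (fun V W f g m s h => frobRel_isStable φ 1 f g m.1 s h)
    (fun V f s h => frobRel_singleValued π hM φ 1 f s h)
    (fun V f m => by
      obtain ⟨S, hS, h⟩ := hN.exists_eq_sum m
      refine ⟨S, hS, fun W g hg => ?_⟩
      obtain ⟨n, a, x, e⟩ := h g hg
      refine ⟨∑ i, a i * φ.1 (g ≫ f) (x i) ^ (p ^ r), ?_⟩
      change ((restr N.toPresheafOfModules g m).1, _) ∈ M.frobRel φ 1 (g ≫ f)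
      exact e ▸ sum_mem_frobRel_one φ (g ≫ f) a x)
  refine ⟨ψ, fun V f n a x m hm => hψ f m _ ?_⟩
  change (m.1, _) ∈ M.frobRel φ 1 f
  exact hm ▸ sum_mem_frobRel_one φ f a x

/-- Additivity and compatibility with restriction both follow from uniqueness. -/
lemma exists_isDualFrobenius (hM : M.IsUnit π) (hN : M.IsRoot N) :
    ∃ Φ : dual N.toPresheafOfModules ⟶ dual N.toPresheafOfModules, M.IsDualFrobenius N Φ := by
  choose Ψ hΨ using fun (U : X.Etale) => exists_isFrobeniusOf (U := U) π hM hN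
  refine ⟨⟨{ app := fun U => AddCommGrpCat.ofHom (AddMonoidHom.mk' (Ψ U.unop) fun φ φ' =>
      (hΨ _ _).unique hN ((hΨ _ _).add π (hΨ _ _))), naturality := fun U U' g => ?_ }⟩,
    fun U φ => hΨ U φ⟩
  refine AddCommGrpCat.hom_ext (AddMonoidHom.ext fun φ => ?_)
  exact (hΨ U'.unop _).unique hN ((hΨ U.unop φ).map g.unop)

/-- A homomorphism on a root which is fixed by `F^r` extends to an `F^r`-linear map. -/
lemma exists_restrict_eq (hM : M.IsUnit π) (hN : M.IsRoot N)
    {φ : homFamilies N.toPresheafOfModules (linearMaps N.toPresheafOfModules) U}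
    (hφ : IsFrobeniusOf φ φ) :
    ∃ t : homFamilies M.val (frobLinearMaps π M) U,
      ∀ ⦃V : X.Etale⦄ (f : V ⟶ U) (x : N.obj (op V)), t.1 f x.1 = φ.1 f x := by
  let L : ℕ → RelationFamily M.val U := fun i => (M.frobRel φ i).localize
  have hmono : ∀ ⦃V : X.Etale⦄ (f : V ⟶ U), Monotone fun i => L i f := fun V f =>
    monotone_nat_of_le_succ fun i => RelationFamily.localize_le (frobRel_le_localize hN hφ i) f
  have hle : ∀ i ⦃V : X.Etale⦄ (f : V ⟶ U), M.frobRel φ i f ≤ L i f := fun i =>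
    (frobRel_isStable φ i).le_localize
  -- The levels increase only after localization. Their supremum is then a directed union, so
  -- membership and single-valuedness can be checked on one level.
  let R : RelationFamily M.val U := fun V f => ⨆ i, L i f
  have hR : ∀ ⦃V : X.Etale⦄ (f : V ⟶ U) {z}, z ∈ R f ↔ ∃ i, z ∈ L i f := fun V f z =>
    Submodule.mem_iSup_of_directed _ (hmono f).directed_le
  have htot : R.IsLocallyTotal := fun V f m => by
    obtain ⟨S, hS, h⟩ := hN.generates V m
    refine ⟨S, hS, fun W g hg => ?_⟩
    refine Submodule.span_induction (p := fun y _ => ∃ s, (y, s) ∈ R (g ≫ f)) ?_ ?_ ?_ ?_ (h g hg)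
    · intro y hy
      obtain ⟨i, x, hx, rfl⟩ := Set.mem_iUnion.1 hy
      obtain ⟨s, hs⟩ := exists_mem_frobRel φ i (g ≫ f) ⟨x, hx⟩
      exact ⟨s, (hR _).2 ⟨i, hle i _ hs⟩⟩
    · exact ⟨0, Submodule.zero_mem _⟩
    · rintro y z _ _ ⟨s, hs⟩ ⟨s', hs'⟩
      exact ⟨s + s', Submodule.add_mem _ hs hs'⟩
    · rintro a y _ ⟨s, hs⟩
      exact ⟨a * s, Submodule.smul_mem _ a hs⟩
  obtain ⟨t, ht⟩ := RelationFamily.exists_homFamily R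
    (fun V W f g m s h => by
      obtain ⟨i, hi⟩ := (hR _).1 h
      exact (hR _).2 ⟨i, RelationFamily.localize_isStable _ f g m s hi⟩)
    (fun V f s h => by
      obtain ⟨i, hi⟩ := (hR _).1 h
      exact RelationFamily.singleValued_localize
        (fun W g => frobRel_singleValued π hM φ i g) f s hi)
    htot
  refine ⟨⟨t.1, fun V f => ⟨t.2.1 f, fun m => ?_⟩, t.2.2⟩, fun V f x =>
    ht f x.1 _ ((hR _).2 ⟨0, hle 0 f (mem_frobRel_zero φ f x)⟩)⟩
  -- Locally a related pair (m, s) lies in some level i. Then (F m, s^q) lies in level i + 1, which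
  -- forces t(F m) = t(m)^q.
  obtain ⟨S, hS, h⟩ := htot f m
  refine etaleO_ext hS fun W g hg => ?_
  obtain ⟨s, hs⟩ := h g hg
  obtain ⟨i, T, hT, hs⟩ := (hR _).1 hs
  refine etaleO_ext hT fun Z g' hg' => ?_
  have h1 := hs g' hg'
  rw [← restr_comp, ← Category.assoc] at h1
  have h2 := mem_frobRel_succ φ h1
  have h3 := M.F_restr (g' ≫ g) m
  change M.F Z (restr M.val (g' ≫ g) m) = restr M.val (g' ≫ g) (M.F V m) at h3
  rw [h3] at h2
  rw [← etaleO_map_comp, ← etaleO_map_comp, map_pow, ← t.2.2, ← t.2.2,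
    ht _ _ _ ((hR _).2 ⟨_, hle _ _ h1⟩), ht _ _ _ ((hR _).2 ⟨_, hle _ _ h2⟩)]

end Unit

end FrobeniusModule

/-! ### Bases, base change and local freeness. -/

section Algebra

lemma IsBaseChangeAlong.exists_basis {A B M N ι : Type*} [CommRing A] [CommRing B] [AddCommGroup M]
    [AddCommGroup N] [Module A M] [Module B N] {φ : A →+* B} {f : M →ₛₗ[φ] N}
    (hf : IsBaseChangeAlong f) (e : Module.Basis ι A M) :
    ∃ e' : Module.Basis ι B N, ∀ i, e' i = f (e i) := by
  let : Algebra A B := φ.toAlgebra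
  let : Module A N := Module.compHom N φ
  have : IsScalarTower A B N := ⟨fun a b n => mul_smul (φ a) b n⟩
  let f' : M →ₗ[A] N :=
    { toFun := f, map_add' := f.map_add, map_smul' := fun a m => f.map_smulₛₗ a m }
  have hf' : IsBaseChange B f' := hf
  exact ⟨(e.baseChange B).map hf'.equiv, fun i => by simp [IsBaseChange.equiv_tmul, f']⟩

/-- Since `r` becomes a unit in `B`, the base change factors through the localization of `A` at `r`,
where the module is already free. -/
lemma free_of_isBaseChangeAlong {A B M N : Type*} [CommRing A] [CommRing B] [AddCommGroup M]
    [AddCommGroup N] [Module A M] [Module B N] {φ : A →+* B} {f : M →ₛₗ[φ] N}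
    (hf : IsBaseChangeAlong f) {r : A} (hr : IsUnit (φ r))
    [Module.Free (Localization (.powers r)) (LocalizedModule.Away r M)] : Module.Free B N := by
  let : Algebra A B := φ.toAlgebra
  let : Module A N := Module.compHom N φ
  have : IsScalarTower A B N := ⟨fun a b n => mul_smul (φ a) b n⟩
  let f' : M →ₗ[A] N :=
    { toFun := f, map_add' := f.map_add, map_smul' := fun a m => f.map_smulₛₗ a m }
  have hf' : IsBaseChange B f' := hf
  let ψ : Localization (.powers r) →+* B := IsLocalization.Away.lift r hr
  have hψ : ∀ a, ψ (algebraMap A _ a) = φ a := fun a => IsLocalization.Away.lift_eq r hr a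
  let : Algebra (Localization (.powers r)) B := ψ.toAlgebra
  let : Module (Localization (.powers r)) N := Module.compHom N ψ
  have : IsScalarTower (Localization (.powers r)) B N := ⟨fun a b n => mul_smul (ψ a) b n⟩
  have : IsScalarTower A (Localization (.powers r)) B := .of_algebraMap_eq fun a => (hψ a).symm
  have : IsScalarTower A (Localization (.powers r)) N := ⟨fun a x n => by
    change ψ (a • x) • n = φ a • ψ x • n
    rw [Algebra.smul_def, map_mul, hψ, mul_smul]⟩
  have h1 : IsBaseChange (Localization (.powers r))
      (LocalizedModule.mkLinearMap (.powers r) M) :=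
    (isLocalizedModule_iff_isBaseChange (.powers r) _ _).mp inferInstance
  have h2 : IsBaseChange B (h1.lift f') := h1.of_comp (by rwa [h1.lift_comp])
  exact .of_basis (((Module.Free.chooseBasis (Localization (.powers r)) _).baseChange B).map
    h2.equiv)

/-- A finite flat module over a noetherian ring is free locally. -/
lemma exists_free_of_flat {A M : Type*} [CommRing A] [IsNoetherianRing A] [AddCommGroup M]
    [Module A M] [Module.Finite A M] [Module.Flat A M] (𝔭 : PrimeSpectrum A) :
    ∃ r ∉ 𝔭.asIdeal, Module.Free (Localization (.powers r)) (LocalizedModule.Away r M) := by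
  have := Module.finitePresentation_of_finite A M
  -- Finitely presented and flat implies free at the prime; finite presentation then spreads
  -- freeness to a basic open neighbourhood.
  have : Module.Free (Localization 𝔭.asIdeal.primeCompl)
      (LocalizedModule 𝔭.asIdeal.primeCompl M) := by
    have : 𝔭 ∈ Module.freeLocus A M := by rw [Module.freeLocus_eq_univ]; trivial
    exact this
  obtain ⟨r, hr, h, -⟩ := Module.FinitePresentation.exists_free_localizedModule_powers
    𝔭.asIdeal.primeCompl (LocalizedModule.mkLinearMap 𝔭.asIdeal.primeCompl M)
    (Localization 𝔭.asIdeal.primeCompl)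
  exact ⟨r, hr, h⟩

end Algebra

/-! ### Affine refinements and étale covers from étale algebras. -/

section Site

variable {X : Scheme.{u}}

lemma exists_finite_cover {ι : Type*} [Finite ι] {U : X.Etale} (S : ι → Sieve U)
    (hS : ∀ i, S i ∈ X.smallEtaleTopology U) :
    ∃ T ∈ X.smallEtaleTopology U, ∀ i, T ≤ S i := by
  classical
  have := Fintype.ofFinite ι
  suffices ∀ s : Finset ι, ∃ T ∈ X.smallEtaleTopology U, ∀ i ∈ s, T ≤ S i by
    obtain ⟨T, hT, h⟩ := this Finset.univ
    exact ⟨T, hT, fun i => h i (Finset.mem_univ i)⟩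
  intro s
  induction s using Finset.induction with
  | empty => exact ⟨⊤, X.smallEtaleTopology.top_mem U, by simp⟩
  | insert i s _ ih =>
    obtain ⟨T, hT, h⟩ := ih
    refine ⟨S i ⊓ T, X.smallEtaleTopology.intersection_covering (hS i) hT, fun j hj => ?_⟩
    rcases Finset.mem_insert.1 hj with rfl | hj
    · exact inf_le_left
    · exact inf_le_right.trans (h j hj)

lemma exists_isAffine_of_mem {U : X.Etale} {S : Sieve U} (hS : S ∈ X.smallEtaleTopology U)
    (x : U.left) :
    ∃ (V : X.Etale) (f : V ⟶ U) (y : V.left), (S f ∧ IsAffine V.left) ∧ f.left y = x := by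
  obtain ⟨V, f, y, hf, rfl⟩ := (mem_smallEtaleTopology_iff S).1 hS x
  obtain ⟨W, g, z, hW, rfl⟩ := exists_isAffine V y
  exact ⟨W, g ≫ f, z, ⟨S.downward_closed hf g, hW⟩, rfl⟩

lemma mem_basicOpen_of_notMem {Y : Scheme.{u}} {y : Y} {r : Γ(Y, ⊤)}
    (hr : r ∉ PrimeSpectrum.asIdeal (R := Γ(Y, ⊤)) (Y.toSpecΓ y)) : y ∈ Y.basicOpen r := by
  rw [← Scheme.toSpecΓ_preimage_basicOpen]
  exact hr

lemma isUnit_basicOpen_ι_appTop {Y : Scheme.{u}} (r : Γ(Y, ⊤)) :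
    IsUnit ((Y.basicOpen r).ι.appTop r) := by
  have h := (Y.toRingedSpace.isUnit_res_basicOpen r).map
    (Y.presheaf.map (homOfLE (Scheme.Opens.ι_image_le (Y.basicOpen r) ⊤)).op).hom
  have e : (Y.basicOpen r).ι.appTop r = Y.presheaf.map
      (homOfLE (Scheme.Opens.ι_image_le (Y.basicOpen r) ⊤)).op
      (Y.presheaf.map (homOfLE (Y.basicOpen_le r)).op r) := by
    rw [Scheme.Opens.ι_appTop, ← CommRingCat.comp_apply, ← Functor.map_comp]
    rfl
  exact e ▸ h

lemma isoSpec_inv_appTop_eq (Y : Scheme.{u}) [IsAffine Y] :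
    Y.isoSpec.inv.appTop = (Scheme.ΓSpecIso Γ(Y, ⊤)).inv := by
  have h : Y.isoSpec.inv.appTop ≫ Y.toSpecΓ.appTop = 𝟙 _ := by
    rw [← Scheme.isoSpec_hom, ← Scheme.Hom.comp_appTop, Iso.hom_inv_id]
    rfl
  rw [Scheme.toSpecΓ_appTop] at h
  exact (Iso.comp_hom_eq_id _).1 h

lemma specMap_isoSpec_inv_appTop {Y : Scheme.{u}} [IsAffine Y] {B : CommRingCat.{u}}
    (h : Γ(Y, ⊤) ⟶ B) : (Spec.map h ≫ Y.isoSpec.inv).appTop = h ≫ (Scheme.ΓSpecIso B).inv := by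
  rw [Scheme.Hom.comp_appTop, isoSpec_inv_appTop_eq, Scheme.ΓSpecIso_inv_naturality]

/-- An affine scheme has a basis of open subschemes where a given function is invertible. -/
lemma exists_isUnit_map {V : X.Etale} (hV : IsAffine V.left) (y : V.left) :
    ∃ 𝔭 : PrimeSpectrum ((etaleO X).obj (op V)), ∀ r ∉ 𝔭.asIdeal,
      ∃ (W : X.Etale) (f : W ⟶ V) (z : W.left), IsAffine W.left ∧ f.left z = y ∧
        IsUnit ((etaleO X).map f.op r) :=
  ⟨V.left.toSpecΓ y, fun r hr => ⟨etaleOver V (V.left.basicOpen r).ι,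
    etaleOverHom V (V.left.basicOpen r).ι, ⟨y, mem_basicOpen_of_notMem hr⟩,
    (isAffineOpen_top V.left).basicOpen r, rfl, isUnit_basicOpen_ι_appTop _⟩⟩

/-- An étale algebra `B` over `O(V)`, for `V` affine, gives an affine étale scheme over `V`, which
covers `V` if `Spec B` does. -/
lemma exists_etale_of_algebra {V : X.Etale} (hV : IsAffine V.left) (B : Type u) [CommRing B]
    [Algebra ((etaleO X).obj (op V)) B] [Algebra.Etale ((etaleO X).obj (op V)) B]
    (hB : Function.Surjective (PrimeSpectrum.comap (algebraMap ((etaleO X).obj (op V)) B)))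
    (y : V.left) :
    ∃ (W : X.Etale) (f : W ⟶ V) (z : W.left) (η : B →+* (etaleO X).obj (op W)), IsAffine W.left ∧
      f.left z = y ∧ ∀ a, η (algebraMap _ B a) = (etaleO X).map f.op a := by
  let h : Γ(V.left, ⊤) ⟶ CommRingCat.of B :=
    CommRingCat.ofHom (algebraMap ((etaleO X).obj (op V)) B)
  have h1 : Etale (Spec.map h) := HasRingHomProperty.Spec_iff.mpr (RingHom.etale_algebraMap.2 ‹_›)
  have : Etale (Spec.map h ≫ V.left.isoSpec.inv) := Etale.etale_comp _ _
  obtain ⟨z, hz⟩ := hB (V.left.isoSpec.hom y)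
  refine ⟨etaleOver V (Spec.map h ≫ V.left.isoSpec.inv),
    etaleOverHom V (Spec.map h ≫ V.left.isoSpec.inv), z, (Scheme.ΓSpecIso (.of B)).inv.hom,
    inferInstanceAs (IsAffine (Spec _)), ?_, fun a => ?_⟩
  · change V.left.isoSpec.inv (Spec.map h z) = y
    have hz' : Spec.map h z = V.left.isoSpec.hom y := hz
    rw [hz']
    exact congr($(V.left.isoSpec.hom_inv_id) y)
  · exact congr($(specMap_isoSpec_inv_appTop h).hom a).symm

end Site

namespace FrobeniusModule

/-! ### Local surjectivity of 1 - F on the dual of a root. -/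

section Surjective

variable {X : Scheme.{u}}

/-- Let `V` be affine and let `P` be a quasi-coherent module with a basis of sections over `V`. There
are homomorphisms `P → O` on the étale site of `V` with given values on this basis. -/
lemma exists_homFamily_of_basis {P : EtPMod X} (hP : IsQuasicoherent P) {V : X.Etale}
    (hV : IsAffine V.left) {ι : Type*} [Finite ι]
    (e : Module.Basis ι ((etaleO X).obj (op V)) (P.obj (op V))) (y : ι → (etaleO X).obj (op V)) :
    ∃ ψ : homFamilies P (linearMaps P) V, ∀ ⦃W : X.Etale⦄ (f : W ⟶ V) (i : ι),
      ψ.1 f (restr P f (e i)) = (etaleO X).map f.op (y i) := by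
  -- The graph of the desired map is spanned by the pairs (eᵢ, yᵢ). Over affines, quasi-coherence
  -- keeps the eᵢ a basis, so there it is single-valued and total; general étale schemes are covered
  -- by affines.
  let R : RelationFamily P V := fun W f => Submodule.span _
    (Set.range fun i => (restr P f (e i), (etaleO X).map f.op (y i)))
  have hmem : ∀ ⦃W : X.Etale⦄ (f : W ⟶ V) (i : ι),
      (restr P f (e i), (etaleO X).map f.op (y i)) ∈ R f := fun W f i =>
    Submodule.subset_span ⟨i, rfl⟩
  have hstab : R.IsStable := fun W W' f g m s h => by
    refine RelationFamily.exists_of_mem_span g ?_ h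
    rintro _ ⟨i, rfl⟩
    rw [← restr_comp, ← etaleO_map_comp]
    exact hmem _ i
  have hsing : ∀ ⦃W : X.Etale⦄ (f : W ⟶ V), IsAffine W.left → SingleValued (R f) := by
    intro W f hW s hs
    obtain ⟨e', he'⟩ := (hP f hV hW).exists_basis e
    have := Fintype.ofFinite ι
    obtain ⟨c, hc⟩ := (Submodule.mem_span_range_iff_exists_fun _).1 hs
    obtain ⟨h1, h2⟩ := Prod.ext_iff.1 hc
    rw [Prod.fst_sum] at h1
    rw [Prod.snd_sum] at h2
    have h0 : ∀ i, c i = 0 := Fintype.linearIndependent_iff.1 e'.linearIndependent c (by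
      simpa [he'] using h1)
    refine h2.symm.trans ?_
    exact Finset.sum_eq_zero fun i _ => by rw [h0, zero_smul]; rfl
  obtain ⟨ψ, hψ⟩ := R.exists_homFamily hstab
    (fun W f s hs => etaleO_ext' (exists_isAffine W) fun W' g hW' => by
      have h1 := hstab f g _ _ hs
      rw [map_zero] at h1
      rw [map_zero, hsing _ hW' _ h1])
    (fun W f m => by
      obtain ⟨S, hS, h⟩ := exists_mem_smallEtaleTopology
        (P := fun W' _ => IsAffine W'.left) (exists_isAffine W)
      refine ⟨S, hS, fun W' g hg => ?_⟩
      obtain ⟨Z, g₁, g₂, hZ, rfl⟩ := h g hg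
      obtain ⟨e', he'⟩ := (hP (g₂ ≫ f) hV hZ).exists_basis e
      have key : ∀ x : P.obj (op Z), ∃ s, (x, s) ∈ R (g₂ ≫ f) := fun x => by
        have hx : x ∈ Submodule.span ((etaleO X).obj (op Z)) (Set.range e') := by rw [e'.span_eq]; trivial
        refine Submodule.span_induction (p := fun x _ => ∃ s, (x, s) ∈ R (g₂ ≫ f)) ?_ ?_ ?_ ?_ hx
        · rintro _ ⟨i, rfl⟩
          rw [he']
          exact ⟨_, hmem _ i⟩
        · exact ⟨0, Submodule.zero_mem _⟩
        · rintro y z _ _ ⟨s, hs⟩ ⟨s', hs'⟩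
          exact ⟨s + s', Submodule.add_mem _ hs hs'⟩
        · rintro a y _ ⟨s, hs⟩
          exact ⟨a * s, Submodule.smul_mem _ a hs⟩
      obtain ⟨s, hs⟩ := key (restr P g₂ m)
      have h1 := hstab _ g₁ _ _ hs
      rw [← restr_comp, ← Category.assoc] at h1
      exact ⟨_, h1⟩)
  exact ⟨ψ, fun W f i => hψ f _ _ (hmem f i)⟩

/-- Two homomorphisms on the étale site of an affine `V` are equal if they agree on a basis. -/
lemma homFamilies_ext_of_basis {P : EtPMod X} (hP : IsQuasicoherent P) {V : X.Etale}
    (hV : IsAffine V.left) {ι : Type*}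
    (e : Module.Basis ι ((etaleO X).obj (op V)) (P.obj (op V)))
    {ψ ψ' : homFamilies P (linearMaps P) V}
    (h : ∀ ⦃W : X.Etale⦄ (f : W ⟶ V) (i : ι),
      ψ.1 f (restr P f (e i)) = ψ'.1 f (restr P f (e i))) : ψ = ψ' := by
  refine Subtype.ext ?_
  funext W f
  refine AddMonoidHom.ext fun m => etaleO_ext' (exists_isAffine W) fun Z g hZ => ?_
  rw [← ψ.2.2, ← ψ'.2.2]
  obtain ⟨e', he'⟩ := (hP (g ≫ f) hV hZ).exists_basis e
  have hx : restr P g m ∈ Submodule.span ((etaleO X).obj (op Z)) (Set.range e') := by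
    rw [e'.span_eq]; trivial
  refine Submodule.span_induction ?_ ?_ ?_ ?_ hx
  · rintro _ ⟨i, rfl⟩
    rw [he']
    exact h _ i
  · rw [map_zero, map_zero]
  · intro x y _ _ hx hy
    rw [map_add, map_add, hx, hy]
  · intro a x _ hx
    rw [ψ.2.1, ψ'.2.1, hx]

variable {q : ℕ}

/-- A torsion-free root is locally free. -/
lemma exists_basis {k : Type u} [Field k] (π : X ⟶ Spec (.of k))
    [SmoothOfRelativeDimension 1 π] {M : FrobeniusModule X q} {N : M.val.Submodule}
    (htf : IsTorsionFree M.val) (hN : M.IsRoot N) (U : X.Etale)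
    (x : U.left) :
    ∃ (V : X.Etale) (f : V ⟶ U) (y : V.left) (ι : Type u) (_ : Finite ι)
      (_ : Module.Basis ι ((etaleO X).obj (op V)) (N.toPresheafOfModules.obj (op V))),
      IsAffine V.left ∧ f.left y = x := by
  obtain ⟨V, f, y, hV, rfl⟩ := exists_isGood π U x
  obtain ⟨g, hg⟩ := hV.exists_etale
  -- A nonzero function on the affine line pulls back to a nonzerodivisor, so the sections of `N`,
  -- lying inside `M`, have no torsion over the polynomial ring.
  have hflat : Module.Flat ((etaleO X).obj (op V)) (N.toPresheafOfModules.obj (op V)) :=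
    flat_of_etale_of_torsionFree hg fun b hb n hn => Subtype.ext
      (htf V hV.isAffine _ (mem_nonZeroDivisors_of_etale hg hb) n.1 (congrArg Subtype.val hn))
  have hfin := hN.isCoherent.2 V hV.isAffine
  have hnoeth : IsNoetherianRing ((etaleO X).obj (op V)) := by
    algebraize [g]
    exact Algebra.FiniteType.isNoetherianRing (MvPolynomial (Fin 1) k) _
  obtain ⟨𝔭, h𝔭⟩ := exists_isUnit_map hV.isAffine y
  obtain ⟨a, ha, hfree⟩ := exists_free_of_flat (M := N.toPresheafOfModules.obj (op V)) 𝔭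
  obtain ⟨W, f', z, hW, rfl, hu⟩ := h𝔭 a ha
  have h1 := free_of_isBaseChangeAlong (hN.isCoherent.1 f' hV.isAffine hW) hu
  have h2 := hN.isCoherent.2 W hW
  exact ⟨W, f' ≫ f, z, _, inferInstance, Module.Free.chooseBasis _ _, hW, rfl⟩

/-- Locally a root has a basis `e`, and `e_i = ∑_j b_ij F(e_j)`. -/
lemma exists_basis_eq_sum {k : Type u} [Field k] (π : X ⟶ Spec (.of k))
    [SmoothOfRelativeDimension 1 π] {M : FrobeniusModule X q} {N : M.val.Submodule}
    (htf : IsTorsionFree M.val) (hN : M.IsRoot N) (U : X.Etale)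
    (x : U.left) :
    ∃ (V : X.Etale) (f : V ⟶ U) (y : V.left) (ι : Type u) (_ : Fintype ι)
      (e : Module.Basis ι ((etaleO X).obj (op V)) (N.toPresheafOfModules.obj (op V)))
      (b : ι → ι → (etaleO X).obj (op V)),
      IsAffine V.left ∧ f.left y = x ∧
        ∀ i, (show N.obj (op V) from e i).1 =
          ∑ j, b i j • M.F V (show N.obj (op V) from e j).1 := by
  obtain ⟨V, f, y, ι, hι, e, hV, rfl⟩ := exists_basis π htf hN U x
  have := Fintype.ofFinite ι
  -- Each basis vector is locally a combination of sections F(c_l). Finitely many covers have a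
  -- common refinement, and expanding c_l in the restricted basis produces the F(eⱼ) with q-th
  -- powers of coordinates as coefficients.
  choose S hS h using fun i => hN.exists_eq_sum (e i)
  obtain ⟨T, hT, hTS⟩ := exists_finite_cover S hS
  obtain ⟨W, g, z, ⟨hg, hW⟩, rfl⟩ := exists_isAffine_of_mem hT y
  obtain ⟨e', he'⟩ := (hN.isCoherent.1 g hV hW).exists_basis e
  have hb : ∀ i, ∃ b : ι → (etaleO X).obj (op W), (show N.obj (op W) from e' i).1 =
      ∑ j, b j • M.F W (show N.obj (op W) from e' j).1 := by
    intro i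
    obtain ⟨n, a, c, hc⟩ := h i g (hTS i _ hg)
    have hsum : ∀ l, M.F W (c l).1 = ∑ j, (e'.repr (c l) j) ^ q •
        M.F W (show N.obj (op W) from e' j).1 := by
      intro l
      have h1 : (c l).1 = ∑ j, e'.repr (c l) j • (show N.obj (op W) from e' j).1 :=
        (congrArg Subtype.val (e'.sum_repr (c l))).symm.trans (map_sum (N.obj (op W)).subtype
          (fun j => (e'.repr (c l) j • (show N.obj (op W) from e' j) : N.obj (op W))) Finset.univ)
      conv_lhs => rw [h1, map_sum]
      exact Finset.sum_congr rfl fun j _ => M.F_smul W _ _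
    refine ⟨fun j => ∑ l, a l * (e'.repr (c l) j) ^ q, ?_⟩
    rw [he']
    refine hc.trans ?_
    simp only [hsum, Finset.smul_sum, Finset.sum_smul, smul_smul]
    exact Finset.sum_comm
  choose b hb using hb
  exact ⟨W, g ≫ f, z, ι, this, e', b, hW, rfl, hb⟩

lemma IsFrobeniusOf.apply_eq_sum {M : FrobeniusModule X q} {N : M.val.Submodule} {U : X.Etale}
    {φ ψ : homFamilies N.toPresheafOfModules (linearMaps N.toPresheafOfModules) U}
    (h : IsFrobeniusOf φ ψ) {V : X.Etale} (f : V ⟶ U) {ι : Type*} [Fintype ι]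
    (a : ι → (etaleO X).obj (op V)) (x : ι → N.obj (op V)) (m : N.obj (op V))
    (hm : m.1 = ∑ i, a i • M.F V (x i).1) : ψ.1 f m = ∑ i, a i * φ.1 f (x i) ^ q := by
  let ε := (Fintype.equivFin ι).symm
  rw [← ε.sum_comp fun i => a i * φ.1 f (x i) ^ q]
  refine h f _ (a ∘ ε) (x ∘ ε) m ?_
  rw [hm, ← ε.sum_comp]
  rfl

variable {k : Type u} [Field k] (π : X ⟶ Spec (.of k)) [SmoothOfRelativeDimension 1 π]
  {p r : ℕ} [Fact p.Prime] [CharP k p] {M : FrobeniusModule X (p ^ r)} {N : M.val.Submodule}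
  {U : X.Etale}

/-- The endomorphism `1 - F^r` of the dual of a torsion-free root is locally surjective. -/
lemma exists_sub_eq (hr : 0 < r) (hM : M.IsUnit π) (htf : IsTorsionFree M.val) (hN : M.IsRoot N)
    (φ : homFamilies N.toPresheafOfModules (linearMaps N.toPresheafOfModules) U) (x : U.left) :
    ∃ (V : X.Etale) (f : V ⟶ U) (y : V.left), f.left y = x ∧
      ∃ ψ ψ' : homFamilies N.toPresheafOfModules (linearMaps N.toPresheafOfModules) V,
        IsFrobeniusOf ψ ψ' ∧ ψ - ψ' = (dual N.toPresheafOfModules).obj.map f.op φ := by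
  obtain ⟨V, f, y, ι, _, e, b, hV, rfl, hb⟩ := exists_basis_eq_sum π htf hN U x
  let c : ι → (etaleO X).obj (op V) := fun i => φ.1 f (e i)
  have hpV := natCast_eq_zero π p V
  have hp : p.Prime := Fact.out
  have := FrobSolutionRing.etale (b := b) (c := c) hp hr hpV
  -- Over `W` the universal solution of yᵢ - ∑ bᵢⱼyⱼ^q = φ(eᵢ) becomes functions `s`, which serve as
  -- the values of ψ on the basis.
  obtain ⟨W, g, z, η, hW, rfl, hη⟩ := exists_etale_of_algebra hV (FrobSolutionRing (p ^ r) b c)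
    (FrobSolutionRing.comap_surjective hp hr hpV) y
  obtain ⟨e', he'⟩ := (hN.isCoherent.1 g hV hW).exists_basis e
  let s : ι → (etaleO X).obj (op W) := fun i => η (FrobSolutionRing.sol _ b c i)
  have hs : ∀ i, s i - ∑ j, (etaleO X).map g.op (b i j) * s j ^ (p ^ r) =
      (etaleO X).map g.op (c i) := fun i => by
    have := congrArg η (FrobSolutionRing.sol_sub (q := p ^ r) (b := b) (c := c) i)
    simpa only [map_sub, map_sum, map_mul, map_pow, hη] using this
  obtain ⟨ψ, hψ⟩ := exists_homFamily_of_basis hN.isCoherent.1 hW e' s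
  obtain ⟨ψ', hψ'⟩ := exists_isFrobeniusOf π hM hN ψ
  refine ⟨W, g ≫ f, z, rfl, ψ, ψ', hψ', ?_⟩
  refine homFamilies_ext_of_basis hN.isCoherent.1 hW e' fun Z h i => ?_
  -- Restricting eᵢ = ∑ bᵢⱼF(eⱼ) lets the formula for ψ' compute its value on eᵢ as ∑ bᵢⱼψ(eⱼ)^q.
  have hm : (restr N.toPresheafOfModules h (e' i)).1 = ∑ j, (etaleO X).map (h ≫ g).op (b i j) •
      M.F Z (show N.obj (op Z) from restr N.toPresheafOfModules h (e' j)).1 := by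
    have h1 : ∀ j, (restr N.toPresheafOfModules h (e' j)).1 =
        restr M.val (h ≫ g) (show N.obj (op V) from e j).1 := fun j => by
      rw [he', restr_comp]
      rfl
    simp only [h1]
    rw [hb i, map_sum]
    refine Finset.sum_congr rfl fun j _ => ?_
    rw [(restr M.val (h ≫ g)).map_smulₛₗ]
    exact congrArg _ (M.F_restr (h ≫ g) _).symm
  have h2 := hψ'.apply_eq_sum h _ _ _ hm
  simp only [hψ] at h2
  have h3 : φ.1 (h ≫ g ≫ f) (restr N.toPresheafOfModules h (e' i)) =
      (etaleO X).map h.op ((etaleO X).map g.op (c i)) := by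
    rw [he', φ.2.2, φ.2.2]
  refine Eq.trans ?_ (Eq.trans (congrArg ((etaleO X).map h.op) (hs i)) h3.symm)
  change ψ.1 h _ - ψ'.1 h _ = _
  rw [h2, hψ, map_sub, map_sum]
  simp only [map_mul, map_pow, etaleO_map_comp]

end Surjective

end FrobeniusModule

/-! ### From statements on sections to short exactness. -/

/-- A criterion for a short complex of sheaves of abelian groups to be short exact. -/
lemma shortExact_of_sections {C : Type v} [Category.{w} C] {J : GrothendieckTopology C}
    [HasSheafify J AddCommGrpCat.{u}]
    (S : ShortComplex (Sheaf J AddCommGrpCat.{u}))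
    (hinj : ∀ U, Function.Injective (S.f.hom.app U))
    (hker : ∀ U (x : S.X₂.obj.obj U), S.g.hom.app U x = 0 → ∃ y, S.f.hom.app U y = x)
    (hsurj : ∀ (U : C) (x : S.X₃.obj.obj (op U)), ∃ T ∈ J U, ∀ ⦃V : C⦄ (f : V ⟶ U), T f →
      ∃ y, S.g.hom.app (op V) y = S.X₃.obj.map f.op x) : S.ShortExact := by
  have hmono : Mono S.f := ⟨fun a b h => by
    refine Sheaf.hom_ext (NatTrans.ext (funext fun U => AddCommGrpCat.hom_ext
      (AddMonoidHom.ext fun z => hinj U ?_)))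
    exact congr(($h).hom.app U z)⟩
  have hepi : Epi S.g := by
    have : Sheaf.IsLocallySurjective S.g := ⟨fun {U} x => by
      obtain ⟨T, hT, h⟩ := hsurj U x
      exact J.superset_covering (fun V f hf => h f hf) hT⟩
    infer_instance
  refine { exact := S.exact_of_f_is_kernel ?_, mono_f := hmono, epi_g := hepi }
  -- Sectionwise preimages are unique by injectivity, hence automatically additive and natural.
  have hlift : ∀ {Z : Sheaf J AddCommGrpCat.{u}} (a : Z ⟶ S.X₂), a ≫ S.g = 0 →
      ∃ l : Z ⟶ S.X₁, l ≫ S.f = a := by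
    intro Z a ha
    choose l hl using fun U (z : Z.obj.obj U) => hker U (a.hom.app U z) congr(($ha).hom.app U z)
    refine ⟨⟨{ app := fun U => AddCommGrpCat.ofHom (AddMonoidHom.mk' (l U) fun x y => hinj U ?_)
               naturality := fun U V f => ?_ }⟩, ?_⟩
    · rw [map_add, hl, hl, hl, map_add]
    · refine AddCommGrpCat.hom_ext (AddMonoidHom.ext fun z => hinj V ?_)
      change S.f.hom.app V (l V (Z.obj.map f z)) = S.f.hom.app V (S.X₁.obj.map f (l U z))
      rw [hl, NatTrans.naturality_apply, NatTrans.naturality_apply, hl]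
    · refine Sheaf.hom_ext (NatTrans.ext (funext fun U => AddCommGrpCat.hom_ext
        (AddMonoidHom.ext fun z => hl U z)))
  exact Limits.KernelFork.IsLimit.ofι _ _ (fun a ha => (hlift a ha).choose)
    (fun a ha => (hlift a ha).choose_spec)
    (fun a ha m hm => (cancel_mono S.f).1 (hm.trans (hlift a ha).choose_spec.symm))

end FrobCurve

theorem mainTheorem4 {k : Type u} [Field k] [IsAlgClosed k] {p r : ℕ} [Fact p.Prime] [CharP k p]
    (hr : 0 < r) {X : Scheme.{u}} (π : X ⟶ Spec (.of k)) [SmoothOfRelativeDimension 1 π]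
    [IsSeparated π] [QuasiCompact π]
    (M : FrobCurve.FrobeniusModule X (p ^ r)) (hM : M.IsLFGU π)
    (htf : FrobCurve.IsTorsionFree M.val)
    (M₀ : M.val.Submodule) (hM₀ : M.IsRoot M₀) :
    ∃ Φ : FrobCurve.dual M₀.toPresheafOfModules ⟶ FrobCurve.dual M₀.toPresheafOfModules,
      M.IsDualFrobenius M₀ Φ ∧ (∀ Ψ, M.IsDualFrobenius M₀ Ψ → Ψ = Φ) ∧
      ∃ w : M.restrict π M₀ ≫ (𝟙 _ - Φ) = 0,
        (ShortComplex.mk (M.restrict π M₀) (𝟙 _ - Φ) w).ShortExact := by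
  obtain ⟨Φ, hΦ⟩ := FrobCurve.FrobeniusModule.exists_isDualFrobenius π hM.1 hM₀
  refine ⟨Φ, hΦ, fun Ψ hΨ => hΦ.unique hM₀ hΨ, ?_, ?_⟩
  · refine Sheaf.hom_ext (NatTrans.ext (funext fun U => AddCommGrpCat.hom_ext
      (AddMonoidHom.ext fun t => ?_)))
    refine sub_eq_zero.2 ?_
    -- The restriction of an F-linear map is its own Frobenius image, so by uniqueness Φ fixes it.
    exact (FrobCurve.FrobeniusModule.isFrobeniusOf_restrict π t fun _ _ _ => rfl).unique hM₀
      (hΦ U.unop ((M.restrict π M₀).hom.app U t))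
  refine FrobCurve.shortExact_of_sections _ (fun U t t' h => ?_) (fun U φ hφ => ?_)
    (fun U φ => ?_)
  · exact FrobCurve.FrobeniusModule.eq_of_restrict_eq π hM₀ fun V f x =>
      congr(($h).1 f x)
  · have h1 := hΦ U.unop φ
    have h2 : Φ.hom.app U φ = φ := (sub_eq_zero.1 hφ).symm
    obtain ⟨t, ht⟩ := FrobCurve.FrobeniusModule.exists_restrict_eq π hM.1 hM₀ (φ := φ)
      (h2.subst (motive := fun ψ => FrobCurve.FrobeniusModule.IsFrobeniusOf φ ψ) h1)
    refine ⟨t, Subtype.ext ?_⟩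
    funext V f
    exact AddMonoidHom.ext fun x => ht f x
  · obtain ⟨S, hS, h⟩ := FrobCurve.exists_mem_smallEtaleTopology (U := U) (P := fun V f =>
      ∃ ψ ψ' : FrobCurve.homFamilies M₀.toPresheafOfModules
        (FrobCurve.linearMaps M₀.toPresheafOfModules) V,
        FrobCurve.FrobeniusModule.IsFrobeniusOf ψ ψ' ∧
          ψ - ψ' = (FrobCurve.dual M₀.toPresheafOfModules).obj.map f.op φ) fun x => by
      obtain ⟨V, f, y, e, h⟩ :=
        FrobCurve.FrobeniusModule.exists_sub_eq π hr hM.1 htf hM₀ φ x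
      exact ⟨V, f, y, h, e⟩
    refine ⟨S, hS, fun V f hf => ?_⟩
    obtain ⟨W, g, f', ⟨ψ, ψ', hψ, e⟩, rfl⟩ := h f hf
    have e' : ψ' = Φ.hom.app (op W) ψ := hψ.unique hM₀ (hΦ W ψ)
    -- An arrow of the covering sieve factors through some `W` where the equation is solved; the
    -- solution is restricted from there.
    refine ⟨(FrobCurve.dual M₀.toPresheafOfModules).obj.map g.op ψ, ?_⟩
    rw [op_comp, Functor.map_comp]
    change _ = (FrobCurve.dual M₀.toPresheafOfModules).obj.map g.op
      ((FrobCurve.dual M₀.toPresheafOfModules).obj.map f'.op φ)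
    rw [← e, e']
    exact NatTrans.naturality_apply (𝟙 _ - Φ : FrobCurve.dual M₀.toPresheafOfModules ⟶ _).hom g.op ψ
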